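/- Conventions. For a pointed path-connected topological space $(X,b)$: * $C_*=C_*(X,b;\mathbb Q)$ is the dg coalgebra of normalized singular chains generated by the singular simplices $\sigma:\Delta^n\to X$ all of whose vertices are sent to $b$, modulo degenerate simplices, with the Alexander–Whitney coproduct $\Delta$; $\bar C_*=C_{*\ge 1}$. * $\Omega C_*$ is its cobar construction: the tensor algebra $T(s^{-1}\bar C_*)$ with the derivation $D$ extending $-s^{-1}\partial s+(s^{-1}\otimes s^{-1})\Delta s$ ($\Delta$ reduced). Write $[\sigma]$ for the generator of degree $n-1$ given by a pointed $n$-simplex, $n\ge1$. Put $\langle\sigma\rangle=[\sigma]$ for $n\ge 2$, $\langle\sigma\rangle=1+[\sigma]$ for $n=1$ and $\langle\sigma\rangle=1$ for $n=0$. * $\nabla:\Omega C_*\to\Omega C_*\otimes\Omega C_*$ is the algebra map (to the graded tensor product) induced by the Serre diagonal of cubes: for a pointed $n$-simplex $\sigma$, $n\ge1$, $\nabla\langle\sigma\rangle=\sum_{0=b_0<b_1<\dots<b_k=n}(-1)^{\sum_{j<k}(b_j-j)}\,\langle\sigma|_{\{b_0,\dots,b_k\}}\rangle\otimes\langle\sigma|_{\{b_0,\dots,b_1\}}\rangle\langle\sigma|_{\{b_1,\dots,b_2\}}\rangle\cdots\langle\sigma|_{\{b_{k-1},\dots,b_k\}}\rangle$,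 where $\{b_{j-1},\dots,b_j\}$ stands for all consecutive vertices from $b_{j-1}$ to $b_j$. Together with the projection onto tensors of length zero, it induces a bialgebra structure on $H_0(\Omega C_*(X,b;\mathbb Q))$. * $\Omega_bX$ is the topological monoid of Moore loops in $X$ at $b$, and $C^\square_*(\Omega_bX;\mathbb Q)$ the dg algebra of normalized singular cubical chains on it. In $\pi_1(X,b)$ the product is concatenation: first the first factor, then the second. * $\theta:\Omega C_*(X,b;\mathbb Q)\to C^\square_*(\Omega_bX;\mathbb Q)$ is Adams' map. In degree $0$ it is given, up to boundaries, by $[\sigma]\mapsto\gamma_\sigma-1$ for a pointed $1$-simplex $\sigma$, where $\gamma_\sigma$ is the Moore loop of length $1$ which runs along $\sigma$ from its vertex $0$ to its vertex $1$. Thus $H_0(\theta)$ is the algebra map sending the class of $1+[\sigma]$ to the class of $\gamma_\sigma$. Theorem. For all pointed path-connected spaces $(X,b)$: 1. The algebra map $H_0(\theta):H_0(\Omega C_*(X,b;\mathbb Q))\to H_0(\Omega_bX;\mathbb Q)$ is an isomorphism, and it is the map induced on $H_0$ by every morphism of dg algebras $\Omega C_*(X,b;\mathbb Q)\to C^\square_*(\Omega_bX;\mathbb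 Q)$ which, up to boundaries, sends $[\sigma]$ to $\gamma_\sigma-1$ for all pointed $1$-simplices $\sigma$. There is an algebra isomorphism $\kappa:H_0(\Omega_bX;\mathbb Q)\cong\mathbb Q[\pi_1(X,b)]$ sending the class of a Moore loop to its class in $\pi_1(X,b)$, and the composite $\Phi=\kappa\circ H_0(\theta):H_0(\Omega C_*(X,b;\mathbb Q))\to\mathbb Q[\pi_1(X,b)]$ is an isomorphism of bialgebras. 2. The bialgebra $H_0(\Omega C_*(X,b;\mathbb Q))$ has an antipode, which makes it a Hopf algebra. 3. There is an isomorphism $e$ from $\pi_1(X,b)$ to the group of group-like elements of $H_0(\Omega C_*(X,b;\mathbb Q))$, with $\Phi(e(g))=g$ for all $g\in\pi_1(X,b)$. 4. All of this is functorial: a pointed continuous map $f:(X,b)\to(Y,c)$ of path-connected spaces induces a bialgebra map $f_*:H_0(\Omega C_*(X,b;\mathbb Q))\to H_0(\Omega C_*(Y,c;\mathbb Q))$, with $\mathrm{id}_*=\mathrm{id}$ and $(g\circ f)_*=g_*\circ f_*$, and $\Phi\circ f_*=\mathbb Q[\pi_1(f)]\circ\Phi$ and $e\circ\pi_1(f)=f_*\circ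 e$. -/

import Mathlib

open scoped TensorProduct DirectSum NNReal

universe u

namespace LoopCobar

noncomputable section

section Chains

variable {X : Type u} [TopologicalSpace X] {b : X}

/-- Singular `n`-simplices of `X` all of whose vertices are sent to the base point `b`. -/
def PSimplex (X : Type u) [TopologicalSpace X] (b : X) (n : ℕ) : Type u :=
  {σ : C(stdSimplex ℝ (Fin (n + 1)), X) // ∀ i, σ (stdSimplex.vertex i) = b}

/-- Precomposition of a pointed simplex with the affine map induced by a map of vertices. -/
def PSimplex.pull {m n : ℕ} (f : Fin (m + 1) → Fin (n + 1)) (σ : PSimplex X b n) :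
    PSimplex X b m :=
  ⟨σ.1.comp ⟨stdSimplex.map f, stdSimplex.continuous_map f⟩, fun i => by
    simp only [ContinuousMap.comp_apply, ContinuousMap.coe_mk, stdSimplex.map_vertex]
    exact σ.2 _⟩

lemma PSimplex.pull_pull {l m n : ℕ} (g : Fin (l + 1) → Fin (m + 1))
    (f : Fin (m + 1) → Fin (n + 1)) (σ : PSimplex X b n) :
    (σ.pull f).pull g = σ.pull (f ∘ g) := by
  apply Subtype.ext
  ext x
  simp only [PSimplex.pull, ContinuousMap.comp_apply, ContinuousMap.coe_mk]
  rw [stdSimplex.map_comp_apply]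

lemma PSimplex.pull_id {n : ℕ} (σ : PSimplex X b n) : σ.pull id = σ := by
  apply Subtype.ext
  ext x
  simp [PSimplex.pull]

/-- The `i`-th face. -/
def PSimplex.face {n : ℕ} (i : Fin (n + 2)) (σ : PSimplex X b (n + 1)) : PSimplex X b n :=
  σ.pull i.succAbove

/-- The `j`-th degeneracy. -/
def PSimplex.degen {n : ℕ} (j : Fin (n + 1)) (σ : PSimplex X b n) : PSimplex X b (n + 1) :=
  σ.pull j.predAbove

/-- Degenerate simplices: those in the image of some degeneracy. -/
def PSimplex.IsDegenerate : {n : ℕ} → PSimplex X b n → Prop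
  | 0, _ => False
  | n + 1, σ => ∃ (j : Fin (n + 1)) (τ : PSimplex X b n), σ = τ.degen j

/-- The front `p`-face, spanned by the vertices `0, …, p`. -/
def PSimplex.front {n p q : ℕ} (h : p + q = n) (σ : PSimplex X b n) : PSimplex X b p :=
  σ.pull fun i => ⟨i, by omega⟩

/-- The back `q`-face, spanned by the vertices `n - q, …, n`. -/
def PSimplex.back {n p q : ℕ} (h : p + q = n) (σ : PSimplex X b n) : PSimplex X b q :=
  σ.pull fun i => ⟨p + i, by omega⟩

lemma succAbove_predAbove_eq {n : ℕ} (j : Fin (n + 1)) (k : Fin (n + 2)) :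
    j.castSucc.succAbove (j.predAbove k) = if k = j.castSucc then j.succ else k := by
  split_ifs with h
  · subst h; simp
  · exact Fin.succAbove_predAbove h

lemma PSimplex.isDegenerate_of_pull {n m : ℕ} (σ : PSimplex X b n)
    (g : Fin (m + 2) → Fin (n + 1)) (i : Fin (m + 1)) (hi : g i.castSucc = g i.succ) :
    (σ.pull g).IsDegenerate := by
  refine ⟨i, (σ.pull g).face i.castSucc, ?_⟩
  rw [PSimplex.face, PSimplex.degen, PSimplex.pull_pull, PSimplex.pull_pull]
  congr 1
  funext k
  simp only [Function.comp, succAbove_predAbove_eq]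
  split_ifs with h
  · subst h; exact hi
  · rfl

lemma PSimplex.isDegenerate_degen_pull {n m : ℕ} (τ : PSimplex X b n) (j : Fin (n + 1))
    (f : Fin (m + 2) → Fin (n + 2)) (i : Fin (m + 1))
    (h₀ : f i.castSucc = j.castSucc) (h₁ : f i.succ = j.succ) :
    ((τ.degen j).pull f).IsDegenerate := by
  rw [PSimplex.degen, PSimplex.pull_pull]
  exact PSimplex.isDegenerate_of_pull _ _ i (by simp [h₀, h₁])

variable (X b) in
/-- The span of the degenerate simplices. -/
def degenerateChains (n : ℕ) : Submodule ℚ (PSimplex X b n →₀ ℚ) :=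
  Submodule.span ℚ ((fun σ => Finsupp.single σ (1 : ℚ)) '' {σ | σ.IsDegenerate})

variable (X b) in
/-- Pointed normalized singular chains in degree `n`: the rational vector space on the pointed
`n`-simplices, modulo the degenerate ones. -/
def NChain (n : ℕ) : Type u := (PSimplex X b n →₀ ℚ) ⧸ degenerateChains X b n

instance (n : ℕ) : AddCommGroup (NChain X b n) :=
  inferInstanceAs (AddCommGroup ((PSimplex X b n →₀ ℚ) ⧸ degenerateChains X b n))

instance (n : ℕ) : Module ℚ (NChain X b n) :=
  inferInstanceAs (Module ℚ ((PSimplex X b n →₀ ℚ) ⧸ degenerateChains X b n))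

/-- The class of a pointed simplex. -/
def NChain.of {n : ℕ} (σ : PSimplex X b n) : NChain X b n :=
  (degenerateChains X b n).mkQ (Finsupp.single σ 1)

lemma NChain.of_eq_zero {n : ℕ} {σ : PSimplex X b n} (h : σ.IsDegenerate) :
    NChain.of σ = 0 :=
  (Submodule.Quotient.mk_eq_zero _).2 (Submodule.subset_span ⟨σ, h, rfl⟩)

/-- Linear extension of a function on simplices which vanishes on degenerate ones. -/
def NChain.lift {n : ℕ} {W : Type*} [AddCommGroup W] [Module ℚ W] (f : PSimplex X b n → W)
    (hf : ∀ σ, σ.IsDegenerate → f σ = 0) : NChain X b n →ₗ[ℚ] W :=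
  (degenerateChains X b n).liftQ (Finsupp.linearCombination ℚ f) <| by
    rw [degenerateChains, Submodule.span_le]
    rintro _ ⟨σ, h, rfl⟩
    simpa using hf σ h

@[simp] lemma NChain.lift_of {n : ℕ} {W : Type*} [AddCommGroup W] [Module ℚ W]
    (f : PSimplex X b n → W) (hf : ∀ σ, σ.IsDegenerate → f σ = 0) (σ : PSimplex X b n) :
    NChain.lift f hf (NChain.of σ) = f σ := by
  refine ((degenerateChains X b n).liftQ_apply _ _).trans ?_
  simp

lemma NChain.hom_ext {n : ℕ} {W : Type*} [AddCommGroup W] [Module ℚ W]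
    {f g : NChain X b n →ₗ[ℚ] W} (h : ∀ σ, f (NChain.of σ) = g (NChain.of σ)) : f = g := by
  apply Submodule.linearMap_qext (degenerateChains X b n)
  refine Finsupp.lhom_ext' fun σ => LinearMap.ext_ring ?_
  exact h σ

/-- The boundary operator `∂ = ∑ (-1)^i d_i`. -/
def NChain.bd (n : ℕ) : NChain X b (n + 1) →ₗ[ℚ] NChain X b n :=
  NChain.lift (fun σ => ∑ i : Fin (n + 2), (-1 : ℚ) ^ (i : ℕ) • NChain.of (σ.face i)) <| by
    rintro _ ⟨j, τ, rfl⟩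
    have key : ∀ i : Fin (n + 2), i ≠ j.castSucc → i ≠ j.succ →
        NChain.of ((τ.degen j).face i) = 0 := by
      intro i h₀ h₁
      apply NChain.of_eq_zero
      rcases n with _ | n
      · exfalso
        simp only [ne_eq, Fin.ext_iff, Fin.val_castSucc, Fin.val_succ] at h₀ h₁
        omega
      · simp only [ne_eq, Fin.ext_iff, Fin.val_castSucc, Fin.val_succ] at h₀ h₁
        rcases Nat.lt_or_ge (i : ℕ) j with hij | hij
        · refine PSimplex.isDegenerate_degen_pull _ _ _ ⟨j - 1, by omega⟩ ?_ ?_ <;>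
          · simp only [Fin.ext_iff, Fin.succAbove, Fin.lt_def, Fin.val_castSucc]
            split_ifs <;> simp at * <;> omega
        · refine PSimplex.isDegenerate_degen_pull _ _ _ ⟨j, by omega⟩ ?_ ?_ <;>
          · simp only [Fin.ext_iff, Fin.succAbove, Fin.lt_def, Fin.val_castSucc]
            split_ifs <;> simp at * <;> omega
    have e₀ : (τ.degen j).face j.castSucc = τ := by
      rw [PSimplex.face, PSimplex.degen, PSimplex.pull_pull]
      convert PSimplex.pull_id τ
      funext k; simp
    have e₁ : (τ.degen j).face j.succ = τ := by
      rw [PSimplex.face, PSimplex.degen, PSimplex.pull_pull]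
      convert PSimplex.pull_id τ
      funext k
      rcases lt_or_ge k.castSucc j.succ with h | h
      · rw [Function.comp, Fin.succAbove_of_castSucc_lt _ _ h, Fin.predAbove_of_le_castSucc]
        · simp
        · exact Fin.le_castSucc_iff.2 h
      · rw [Function.comp, Fin.succAbove_of_le_castSucc _ _ h, Fin.predAbove_of_castSucc_lt]
        · simp
        · exact lt_of_lt_of_le (Fin.castSucc_lt_succ) (h.trans Fin.castSucc_lt_succ.le)
    rw [Finset.sum_eq_add (j.castSucc) (j.succ) (by simp [Fin.ext_iff])
      (fun i _ h => by rw [key i h.1 h.2, smul_zero]) (by simp) (by simp), e₀, e₁]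
    simp [pow_succ]

/-- The component `C_n → C_p ⊗ C_q` (`p + q = n`) of the Alexander-Whitney coproduct. -/
def NChain.aw {n p q : ℕ} (h : p + q = n) :
    NChain X b n →ₗ[ℚ] NChain X b p ⊗[ℚ] NChain X b q :=
  NChain.lift (fun σ => NChain.of (σ.front h) ⊗ₜ[ℚ] NChain.of (σ.back h)) <| by
    intro σ hσ
    rcases n with _ | n
    · exact hσ.elim
    obtain ⟨j, τ, rfl⟩ := hσ
    rcases Nat.lt_or_ge (j : ℕ) p with hj | hj
    · obtain ⟨p, rfl⟩ : ∃ p', p = p' + 1 := ⟨p - 1, by omega⟩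
      rw [NChain.of_eq_zero (σ := PSimplex.front h _), TensorProduct.zero_tmul]
      exact PSimplex.isDegenerate_degen_pull _ _ _ ⟨j, by omega⟩ (by simp [Fin.ext_iff])
        (by simp [Fin.ext_iff])
    · obtain ⟨q, rfl⟩ : ∃ q', q = q' + 1 := ⟨q - 1, by omega⟩
      rw [NChain.of_eq_zero (σ := PSimplex.back h _), TensorProduct.tmul_zero]
      exact PSimplex.isDegenerate_degen_pull _ _ _ ⟨j - p, by omega⟩
        (by simp [Fin.ext_iff]; omega) (by simp [Fin.ext_iff]; omega)

end Chains

section DGAlgebra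

variable {A B : Type*} [Ring A] [Algebra ℚ A] [Ring B] [Algebra ℚ B]

/-- `(A, 𝒜, d)` is a differential graded algebra (non-negatively graded, with `d` of degree
`-1`). -/
class IsDGAlgebra (𝒜 : ℕ → Submodule ℚ A) [GradedAlgebra 𝒜] (d : A →ₗ[ℚ] A) : Prop where
  d_mem : ∀ {n : ℕ} {a : A}, a ∈ 𝒜 (n + 1) → d a ∈ 𝒜 n
  d_zero : ∀ {a : A}, a ∈ 𝒜 0 → d a = 0
  leibniz : ∀ {n : ℕ} {a : A} (c : A), a ∈ 𝒜 n → d (a * c) = d a * c + (-1 : ℚ) ^ n • (a * d c)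
  d_d : ∀ a : A, d (d a) = 0

variable (𝒜 : ℕ → Submodule ℚ A) [GradedAlgebra 𝒜] (d : A →ₗ[ℚ] A) [IsDGAlgebra 𝒜 d]
variable (ℬ : ℕ → Submodule ℚ B) [GradedAlgebra ℬ] (d' : B →ₗ[ℚ] B) [IsDGAlgebra ℬ d']

/-- Cycles of degree zero. -/
def cycles₀ : Subalgebra ℚ A where
  carrier := {a | a ∈ 𝒜 0 ∧ d a = 0}
  mul_mem' {a c} ha hc := ⟨by simpa using SetLike.mul_mem_graded ha.1 hc.1,
    by rw [IsDGAlgebra.leibniz (𝒜 := 𝒜) c ha.1, ha.2, hc.2]; simp⟩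
  add_mem' {a c} ha hc := ⟨add_mem ha.1 hc.1, by rw [map_add, ha.2, hc.2, add_zero]⟩
  algebraMap_mem' r := ⟨SetLike.algebraMap_mem_graded 𝒜 r,
    IsDGAlgebra.d_zero (𝒜 := 𝒜) (SetLike.algebraMap_mem_graded 𝒜 r)⟩

/-- Boundaries of degree zero, an ideal of the algebra of cycles of degree zero. -/
def boundaries₀ : Ideal (cycles₀ 𝒜 d) where
  carrier := {a | ∃ c ∈ 𝒜 1, d c = a}
  add_mem' := by
    rintro _ _ ⟨c, hc, h⟩ ⟨c', hc', h'⟩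
    exact ⟨c + c', add_mem hc hc', by rw [map_add, h, h']; rfl⟩
  zero_mem' := ⟨0, zero_mem _, by simp⟩
  smul_mem' := by
    rintro a _ ⟨c, hc, h⟩
    refine ⟨a * c, by simpa using SetLike.mul_mem_graded a.2.1 hc, ?_⟩
    rw [IsDGAlgebra.leibniz (𝒜 := 𝒜) c a.2.1, a.2.2, h]
    simp

instance : (boundaries₀ 𝒜 d).IsTwoSided where
  mul_mem_of_left := by
    rintro _ a ⟨c, hc, h⟩
    refine ⟨c * a, by simpa using SetLike.mul_mem_graded hc a.2.1, ?_⟩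
    rw [IsDGAlgebra.leibniz (𝒜 := 𝒜) (a : A) hc, a.2.2, h]
    simp

/-- The zeroth homology algebra `H₀ = Z₀ / B₀` of a differential graded algebra. -/
def H0 : Type _ := cycles₀ 𝒜 d ⧸ boundaries₀ 𝒜 d

instance : Ring (H0 𝒜 d) := inferInstanceAs (Ring (cycles₀ 𝒜 d ⧸ boundaries₀ 𝒜 d))
instance : Algebra ℚ (H0 𝒜 d) := inferInstanceAs (Algebra ℚ (cycles₀ 𝒜 d ⧸ boundaries₀ 𝒜 d))

/-- The homology class of a cycle of degree zero. -/
def H0.mk : cycles₀ 𝒜 d →ₐ[ℚ] H0 𝒜 d := Ideal.Quotient.mkₐ ℚ (boundaries₀ 𝒜 d)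

lemma H0.mk_surjective : Function.Surjective (H0.mk 𝒜 d) :=
  Ideal.Quotient.mkₐ_surjective ℚ (boundaries₀ 𝒜 d)

variable {𝒜 d} in
lemma H0.mk_eq_zero {z : cycles₀ 𝒜 d} : H0.mk 𝒜 d z = 0 ↔ ∃ c ∈ 𝒜 1, d c = z :=
  Ideal.Quotient.eq_zero_iff_mem

variable {𝒜 d} in
/-- Algebra maps out of `H₀`. -/
def H0.lift {W : Type*} [Semiring W] [Algebra ℚ W] (f : cycles₀ 𝒜 d →ₐ[ℚ] W)
    (hf : ∀ z : cycles₀ 𝒜 d, ∀ c ∈ 𝒜 1, d c = z → f z = 0) : H0 𝒜 d →ₐ[ℚ] W :=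
  Ideal.Quotient.liftₐ (boundaries₀ 𝒜 d) f (fun z ⟨c, hc, h⟩ => hf z c hc h)

@[simp] lemma H0.lift_mk {W : Type*} [Semiring W] [Algebra ℚ W] (f : cycles₀ 𝒜 d →ₐ[ℚ] W)
    (hf : ∀ z : cycles₀ 𝒜 d, ∀ c ∈ 𝒜 1, d c = z → f z = 0) (z : cycles₀ 𝒜 d) :
    H0.lift f hf (H0.mk 𝒜 d z) = f z := rfl

/-- Every element of degree zero is a cycle. -/
def cycle (a : A) (ha : a ∈ 𝒜 0) : cycles₀ 𝒜 d := ⟨a, ha, IsDGAlgebra.d_zero (𝒜 := 𝒜) ha⟩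

/-- A morphism of differential graded algebras. -/
structure IsDGHom (f : A →ₐ[ℚ] B) : Prop where
  map_mem : ∀ {n : ℕ} {a : A}, a ∈ 𝒜 n → f a ∈ ℬ n
  map_d : ∀ a : A, f (d a) = d' (f a)

variable {𝒜 d ℬ d'} in
/-- The map induced on cycles of degree zero. -/
def IsDGHom.cyclesMap {f : A →ₐ[ℚ] B} (hf : IsDGHom 𝒜 d ℬ d' f) :
    cycles₀ 𝒜 d →ₐ[ℚ] cycles₀ ℬ d' :=
  (f.comp (cycles₀ 𝒜 d).val).codRestrict _ fun z =>
    ⟨hf.map_mem z.2.1, by simpa [z.2.2] using (hf.map_d (z : A)).symm⟩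

variable {𝒜 d ℬ d'} in
/-- The algebra map induced on `H₀` by a morphism of differential graded algebras. -/
def IsDGHom.H0map {f : A →ₐ[ℚ] B} (hf : IsDGHom 𝒜 d ℬ d' f) : H0 𝒜 d →ₐ[ℚ] H0 ℬ d' :=
  H0.lift ((H0.mk ℬ d').comp hf.cyclesMap) fun z c hc h =>
    H0.mk_eq_zero.2 ⟨f c, hf.map_mem hc, by rw [← hf.map_d, h]; rfl⟩

end DGAlgebra

section TensorAlg

variable (M : ℕ → Type u) [∀ n, AddCommGroup (M n)] [∀ n, Module ℚ (M n)]

/-- The tensor algebra of a non-negatively graded vector space `⨁ M n`. -/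
abbrev TA : Type u := TensorAlgebra ℚ (⨁ n, M n)

namespace TA

variable {M} in
/-- The inclusion of the generators of degree `n`. -/
def gen (n : ℕ) : M n →ₗ[ℚ] TA M :=
  TensorAlgebra.ι ℚ ∘ₗ DirectSum.lof ℚ ℕ M n

/-- The elements of total degree `m`: linear combinations of products of generators whose degrees
add up to `m`. -/
def gr (m : ℕ) : Submodule ℚ (TA M) :=
  Submodule.span ℚ {x | ∃ l : List (Σ n, M n),
    (l.map Sigma.fst).sum = m ∧ (l.map fun p => gen p.1 p.2).prod = x}

variable {M}

lemma gen_mem {n : ℕ} (x : M n) : gen n x ∈ gr M n :=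
  Submodule.subset_span ⟨[⟨n, x⟩], by simp, by simp⟩

instance : SetLike.GradedMonoid (gr M) where
  one_mem := Submodule.subset_span ⟨[], by simp, by simp⟩
  mul_mem := by
    intro i j x y hx hy
    have : x * y ∈ gr M i * gr M j := Submodule.mul_mem_mul hx hy
    rw [gr, gr, Submodule.span_mul_span] at this
    refine Submodule.span_mono ?_ this
    rintro _ ⟨_, ⟨l, hl, rfl⟩, _, ⟨l', hl', rfl⟩, rfl⟩
    exact ⟨l ++ l', by simp [hl, hl'], by simp⟩

lemma hom_ext {W : Type*} [Semiring W] [Algebra ℚ W] {f g : TA M →ₐ[ℚ] W}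
    (h : ∀ n (x : M n), f (gen n x) = g (gen n x)) : f = g := by
  refine TensorAlgebra.hom_ext (DirectSum.linearMap_ext _ fun n => LinearMap.ext fun x => ?_)
  exact h n x

/-- The algebra map out of the tensor algebra with given values on generators. -/
def lift {W : Type*} [Semiring W] [Algebra ℚ W] (f : ∀ n, M n →ₗ[ℚ] W) : TA M →ₐ[ℚ] W :=
  TensorAlgebra.lift ℚ (DirectSum.toModule ℚ ℕ W f)

@[simp] lemma lift_gen {W : Type*} [Semiring W] [Algebra ℚ W] (f : ∀ n, M n →ₗ[ℚ] W) (n : ℕ)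
    (x : M n) : lift f (gen n x) = f n x := by
  simp [lift, gen]

instance : GradedAlgebra (gr M) :=
  GradedAlgebra.ofAlgHom (gr M)
    (lift fun n => DirectSum.lof ℚ ℕ (fun i => gr M i) n ∘ₗ
      (gen n).codRestrict (gr M n) gen_mem)
    (hom_ext fun n x => by
      simp only [AlgHom.comp_apply, lift_gen, LinearMap.comp_apply, DirectSum.lof_eq_of,
        DirectSum.coeAlgHom_of]
      rfl)
    (by
      rintro i ⟨x, hx⟩
      induction hx using Submodule.span_induction with
      | zero => simp only [map_zero]; exact (map_zero (DirectSum.of (fun i => gr M i) i)).symm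
      | add x y hx hy ihx ihy =>
        simp only [map_add, ihx, ihy]
        exact (map_add (DirectSum.of (fun i => gr M i) i) _ _).symm
      | smul r x hx ih =>
        simp only [map_smul, ih]
        exact (map_smul (DirectSum.lof ℚ ℕ (fun i => gr M i) i) _ _).symm
      | mem x hx =>
        obtain ⟨l, rfl, rfl⟩ := hx
        induction l with
        | nil => simp; rfl
        | cons p l ih =>
          simp only [List.map_cons, List.prod_cons, map_mul]
          rw [ih, lift_gen, LinearMap.comp_apply,
            DirectSum.lof_eq_of, DirectSum.of_mul_of]
          rfl)

/-- The parity involution `x ↦ (-1)^|x| x`. -/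
def parity : TA M →ₐ[ℚ] TA M := lift fun n => (-1 : ℚ) ^ n • gen n

lemma parity_of_mem {n : ℕ} {x : TA M} (hx : x ∈ gr M n) : parity x = (-1 : ℚ) ^ n • x := by
  induction hx using Submodule.span_induction with
  | zero => simp
  | add x y hx hy ihx ihy => rw [map_add, ihx, ihy, smul_add]
  | smul r x hx ih => rw [map_smul, ih, smul_comm]
  | mem x hx =>
    obtain ⟨l, rfl, rfl⟩ := hx
    induction l with
    | nil => simp
    | cons p l ih =>
      simp only [List.map_cons, List.prod_cons, List.sum_cons, map_mul, ih]
      rw [parity, lift_gen, LinearMap.smul_apply, smul_mul_smul_comm, ← pow_add]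

/-- Auxiliary: `x ↦ [[(-1)^|x| x, δ x], [0, x]]`; algebra maps of this form are the same as graded
derivations. -/
def derivMat (δ : ∀ n, M n →ₗ[ℚ] TA M) : TA M →ₐ[ℚ] Matrix (Fin 2) (Fin 2) (TA M) :=
  lift fun n =>
    { toFun := fun x => !![(-1 : ℚ) ^ n • gen n x, δ n x; 0, gen n x]
      map_add' := fun x y => by ext i j; fin_cases i <;> fin_cases j <;> simp
      map_smul' := fun r x => by
        ext i j; fin_cases i <;> fin_cases j <;> simp [smul_comm r] }

/-- The unique graded derivation extending `δ` on generators. -/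
def deriv (δ : ∀ n, M n →ₗ[ℚ] TA M) : TA M →ₗ[ℚ] TA M where
  toFun x := derivMat δ x 0 1
  map_add' x y := by simp
  map_smul' r x := by simp

@[simp] lemma deriv_gen (δ : ∀ n, M n →ₗ[ℚ] TA M) (n : ℕ) (x : M n) :
    deriv δ (gen n x) = δ n x := by
  simp [deriv, derivMat]

lemma derivMat_apply (δ : ∀ n, M n →ₗ[ℚ] TA M) (x : TA M) :
    derivMat δ x = !![parity x, deriv δ x; 0, x] := by
  have h : ∀ x, derivMat δ x 0 0 = parity x ∧ derivMat δ x 1 0 = 0 ∧ derivMat δ x 1 1 = x := by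
    intro x
    induction x using TensorAlgebra.induction with
    | algebraMap r => simp [Matrix.algebraMap_matrix_apply]
    | ι v =>
      induction v using DirectSum.induction_on with
      | zero => simp
      | of n x =>
        have : TensorAlgebra.ι ℚ (DirectSum.of M n x) = gen n x := rfl
        rw [this]
        simp [derivMat, parity]
      | add x y hx hy => simp [hx, hy]
    | mul x y hx hy => simp [Matrix.mul_apply, Fin.sum_univ_two, hx, hy]
    | add x y hx hy => simp [hx, hy]
  obtain ⟨h₁, h₂, h₃⟩ := h x
  ext i j
  fin_cases i <;> fin_cases j
  · simpa using h₁
  · rfl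
  · simpa using h₂
  · simpa using h₃

lemma deriv_mul (δ : ∀ n, M n →ₗ[ℚ] TA M) (x y : TA M) :
    deriv δ (x * y) = deriv δ x * y + parity x * deriv δ y := by
  have := congrFun (congrFun (map_mul (derivMat δ) x y) 0) 1
  rw [derivMat_apply, derivMat_apply, derivMat_apply] at this
  simpa [Matrix.mul_apply, Fin.sum_univ_two, add_comm] using this

@[simp] lemma deriv_one (δ : ∀ n, M n →ₗ[ℚ] TA M) : deriv δ 1 = 0 := by
  simp [deriv]

@[simp] lemma deriv_algebraMap (δ : ∀ n, M n →ₗ[ℚ] TA M) (r : ℚ) :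
    deriv δ (algebraMap ℚ (TA M) r) = 0 := by
  rw [Algebra.algebraMap_eq_smul_one, map_smul, deriv_one, smul_zero]

lemma induction_gen {C : TA M → Prop} (halg : ∀ r, C (algebraMap ℚ _ r))
    (hgen : ∀ n (x : M n), C (gen n x)) (hmul : ∀ x y, C x → C y → C (x * y))
    (hadd : ∀ x y, C x → C y → C (x + y)) (x : TA M) : C x := by
  induction x using TensorAlgebra.induction with
  | algebraMap r => exact halg r
  | ι v =>
    induction v using DirectSum.induction_on with
    | zero => simpa using halg 0
    | of n x => exact hgen n x
    | add x y hx hy => rw [map_add]; exact hadd _ _ hx hy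
  | mul x y hx hy => exact hmul _ _ hx hy
  | add x y hx hy => exact hadd _ _ hx hy

/-- A graded derivation of degree `-1` on generators has degree `-1`. -/
lemma deriv_mem (δ : ∀ n, M n →ₗ[ℚ] TA M) (h₀ : δ 0 = 0)
    (h : ∀ n x, δ (n + 1) x ∈ gr M n) :
    (∀ x ∈ gr M 0, deriv δ x = 0) ∧ ∀ n, ∀ x ∈ gr M (n + 1), deriv δ x ∈ gr M n := by
  have key : ∀ l : List (Σ n, M n),
      ((l.map Sigma.fst).sum = 0 → deriv δ (l.map fun p => gen p.1 p.2).prod = 0) ∧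
      ∀ n, (l.map Sigma.fst).sum = n + 1 →
        deriv δ (l.map fun p => gen p.1 p.2).prod ∈ gr M n := by
    intro l
    induction l with
    | nil => simp
    | cons p l ih =>
      obtain ⟨k, x⟩ := p
      have hl : (l.map fun p => gen p.1 p.2).prod ∈ gr M (l.map Sigma.fst).sum :=
        Submodule.subset_span ⟨l, rfl, rfl⟩
      simp only [List.map_cons, List.prod_cons, List.sum_cons, deriv_mul, deriv_gen,
        parity_of_mem (gen_mem x)]
      constructor
      · intro h0
        obtain ⟨rfl, h1⟩ : k = 0 ∧ (l.map Sigma.fst).sum = 0 := by omega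
        simp [h₀, ih.1 h1]
      · intro n hn
        refine add_mem ?_ ?_
        · rcases k with _ | k
          · simp [h₀]
          · have : n = k + (l.map Sigma.fst).sum := by omega
            rw [this]
            exact SetLike.mul_mem_graded (h k x) hl
        · rw [smul_mul_assoc]
          refine Submodule.smul_mem _ _ ?_
          rcases hs : (l.map Sigma.fst).sum with _ | s
          · rw [ih.1 hs]; simp
          · have : n = k + s := by omega
            rw [this]
            exact SetLike.mul_mem_graded (gen_mem x) (ih.2 s hs)
  constructor
  · intro x hx
    induction hx using Submodule.span_induction with
    | zero => simp
    | add x y hx hy ihx ihy => rw [map_add, ihx, ihy, add_zero]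
    | smul r x hx ih => rw [map_smul, ih, smul_zero]
    | mem x hx => obtain ⟨l, h0, rfl⟩ := hx; exact (key l).1 h0
  · intro n x hx
    induction hx using Submodule.span_induction with
    | zero => simp
    | add x y hx hy ihx ihy => rw [map_add]; exact add_mem ihx ihy
    | smul r x hx ih => rw [map_smul]; exact Submodule.smul_mem _ _ ih
    | mem x hx => obtain ⟨l, h0, rfl⟩ := hx; exact (key l).2 n h0

lemma deriv_deriv (δ : ∀ n, M n →ₗ[ℚ] TA M)
    (hp : ∀ n x, parity (δ n x) = - (-1 : ℚ) ^ n • δ n x)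
    (h : ∀ n x, deriv δ (δ n x) = 0) (x : TA M) : deriv δ (deriv δ x) = 0 := by
  have hpar : ∀ x, parity (deriv δ x) = - deriv δ (parity x) := by
    intro x
    induction x using induction_gen with
    | halg r => simp
    | hgen n x => simp [hp, parity_of_mem (gen_mem x)]
    | hmul x y hx hy =>
      rw [deriv_mul, map_add, map_mul, map_mul, hx, hy, map_mul parity x y, deriv_mul]
      noncomm_ring
    | hadd x y hx hy => simp [hx, hy, add_comm]
  induction x using induction_gen with
  | halg r => simp
  | hgen n x => simp [h]
  | hmul x y hx hy => simp [deriv_mul, hx, hy, hpar]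
  | hadd x y hx hy => simp [hx, hy]

end TA

end TensorAlg

section Cobar

variable {X : Type u} [TopologicalSpace X] {b : X}

/-- The underlying algebra of the cobar construction `Ω C_*(X, b; ℚ)`: the tensor algebra on the
desuspension `s⁻¹ C̄`, so that the generators of degree `n` are the normalized pointed chains of
degree `n + 1`. -/
abbrev Cobar (X : Type u) [TopologicalSpace X] (b : X) : Type u :=
  TA fun n => NChain X b (n + 1)

/-- The total grading of the cobar construction. -/
abbrev cobarGr (X : Type u) [TopologicalSpace X] (b : X) : ℕ → Submodule ℚ (Cobar X b) :=
  TA.gr fun n => NChain X b (n + 1)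

/-- The map `- s⁻¹ ∂ s + (s⁻¹ ⊗ s⁻¹) Δ s` on generators, with the Koszul sign
`(s⁻¹ ⊗ s⁻¹) (x ⊗ y) = (-1)^|x| s⁻¹ x ⊗ s⁻¹ y`. -/
def cobarDGen : ∀ n, NChain X b (n + 1) →ₗ[ℚ] Cobar X b
  | 0 => 0
  | m + 1 => - (TA.gen (M := fun n => NChain X b (n + 1)) m ∘ₗ NChain.bd (m + 1)) +
      ∑ i : Fin (m + 1), (-1 : ℚ) ^ ((i : ℕ) + 1) •
        (LinearMap.mul' ℚ (Cobar X b) ∘ₗ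
          TensorProduct.map (TA.gen (M := fun n => NChain X b (n + 1)) (i : ℕ))
            (TA.gen (M := fun n => NChain X b (n + 1)) (m - i)) ∘ₗ
          NChain.aw (p := i + 1) (q := m - i + 1) (by omega))

/-- The differential of the cobar construction. -/
def cobarD (X : Type u) [TopologicalSpace X] (b : X) : Cobar X b →ₗ[ℚ] Cobar X b :=
  TA.deriv cobarDGen

/-- The generator `[σ]` of the cobar construction given by a pointed simplex of dimension `n + 1`. -/
def cobarGen {n : ℕ} (σ : PSimplex X b (n + 1)) : Cobar X b :=
  TA.gen (M := fun n => NChain X b (n + 1)) n (NChain.of σ)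

lemma cobarGen_mem {n : ℕ} (σ : PSimplex X b (n + 1)) : cobarGen σ ∈ cobarGr X b n :=
  TA.gen_mem _

lemma cobarGen_eq_zero {n : ℕ} {σ : PSimplex X b (n + 1)} (h : σ.IsDegenerate) :
    cobarGen σ = 0 := by
  rw [cobarGen, NChain.of_eq_zero h, map_zero]

/-- The element of the cobar construction corresponding to the cube of paths of a simplex: it is
`[σ]`, except for `1`-simplices, where it is `1 + [σ]` (and `1` for the `0`-simplex). -/
def cubeGen : {n : ℕ} → PSimplex X b n → Cobar X b
  | 0, _ => 1
  | 1, σ => 1 + cobarGen σ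
  | _ + 2, σ => cobarGen σ

lemma cubeGen_eq_zero {n : ℕ} {σ : PSimplex X b n} (hn : 2 ≤ n) (h : σ.IsDegenerate) :
    cubeGen σ = 0 := by
  obtain ⟨n, rfl⟩ : ∃ k, n = k + 2 := ⟨n - 2, by omega⟩
  exact cobarGen_eq_zero h

lemma cubeGen_mem {n : ℕ} (σ : PSimplex X b n) : cubeGen σ ∈ cobarGr X b (n - 1) := by
  rcases n with _ | _ | n
  · exact SetLike.one_mem_graded (cobarGr X b)
  · exact add_mem (SetLike.one_mem_graded (cobarGr X b)) (cobarGen_mem σ)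
  · exact cobarGen_mem σ

lemma cobarD_gen_zero (σ : PSimplex X b 1) : cobarD X b (cobarGen σ) = 0 := by
  simp [cobarD, cobarGen, cobarDGen]

lemma cobarD_gen_succ {m : ℕ} (σ : PSimplex X b (m + 2)) :
    cobarD X b (cobarGen σ) = - ∑ i : Fin (m + 3), (-1 : ℚ) ^ (i : ℕ) • cobarGen (σ.face i) +
      ∑ i : Fin (m + 1), (-1 : ℚ) ^ ((i : ℕ) + 1) •
        (cobarGen (σ.front (p := i + 1) (q := m - i + 1) (by omega)) *
          cobarGen (σ.back (p := i + 1) (q := m - i + 1) (by omega))) := by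
  simp only [cobarD, cobarGen, TA.deriv_gen]
  simp only [cobarDGen, LinearMap.add_apply, LinearMap.neg_apply, LinearMap.comp_apply,
    LinearMap.sum_apply, LinearMap.smul_apply, NChain.bd, NChain.aw, NChain.lift_of, map_sum,
    map_smul, TensorProduct.map_tmul, LinearMap.mul'_apply]

/-- The generator of a simplex, `0` in dimension `0`. -/
def cobarGen' : {n : ℕ} → PSimplex X b n → Cobar X b
  | 0, _ => 0
  | _ + 1, σ => cobarGen σ

lemma cubeGen_eq {n : ℕ} (hn : 0 < n) (σ : PSimplex X b n) :
    cubeGen σ = cobarGen' σ + if n = 1 then 1 else 0 := by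
  rcases n with _ | _ | n
  · omega
  · simp [cubeGen, cobarGen', add_comm]
  · simp [cubeGen, cobarGen']

lemma pull_congr {β : Type*} (F : ∀ {k : ℕ}, PSimplex X b k → β) {n p p' : ℕ} (hp : p = p')
    (σ : PSimplex X b n) (f : Fin (p + 1) → Fin (n + 1)) (f' : Fin (p' + 1) → Fin (n + 1))
    (h : ∀ (i : ℕ) (hi : i < p + 1) (hi' : i < p' + 1), (f ⟨i, hi⟩ : ℕ) = f' ⟨i, hi'⟩) :
    F (σ.pull f) = F (σ.pull f') := by
  subst hp
  congr 2
  funext i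
  exact Fin.ext (h i i.2 i.2)

/-- `D` in terms of the elements `cubeGen`: the differential of a cube. -/
lemma cobarD_cubeGen {m : ℕ} (σ : PSimplex X b (m + 1)) :
    cobarD X b (cubeGen σ) = ∑ i : Fin m, (-1 : ℚ) ^ (i : ℕ) •
      (cubeGen (σ.face (n := m) i.succ.castSucc) -
        cubeGen (σ.front (p := i + 1) (q := m - i) (by omega)) *
          cubeGen (σ.back (p := i + 1) (q := m - i) (by omega))) := by
  rcases m with _ | k
  · have : cobarD X b 1 = 0 := TA.deriv_one _
    simp [cubeGen, this, cobarD_gen_zero]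
  have e : ∀ i : Fin (k + 1), (-1 : ℚ) ^ (i : ℕ) •
      (cubeGen (σ.face (n := k + 1) i.succ.castSucc) -
        cubeGen (σ.front (p := i + 1) (q := k + 1 - i) (by omega)) *
          cubeGen (σ.back (p := i + 1) (q := k + 1 - i) (by omega))) =
      (-1 : ℚ) ^ (i : ℕ) • cobarGen (σ.face i.succ.castSucc) -
      (-1 : ℚ) ^ (i : ℕ) • (cobarGen (σ.front (p := i + 1) (q := k - i + 1) (by omega)) *
          cobarGen (σ.back (p := i + 1) (q := k - i + 1) (by omega))) -
      (if i = 0 then cobarGen (σ.face 0) else 0) -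
      (if i = Fin.last k then (-1 : ℚ) ^ k • cobarGen (σ.face (Fin.last _)) else 0) := by
    intro i
    have hF : cobarGen' (σ.front (p := i + 1) (q := k + 1 - i) (by omega)) =
      cobarGen (σ.front (p := i + 1) (q := k - i + 1) (by omega)) := rfl
    have hB : cobarGen' (σ.back (p := i + 1) (q := k + 1 - i) (by omega)) =
      cobarGen (σ.back (p := i + 1) (q := k - i + 1) (by omega)) :=
      pull_congr (p := k + 1 - i) (p' := k - i + 1) cobarGen' (by omega) σ
        (fun j => ⟨i + 1 + j, by omega⟩) (fun j => ⟨i + 1 + j, by omega⟩) (fun _ _ _ => rfl)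
    have hface : cobarGen' (σ.face (n := k + 1) i.succ.castSucc) =
      cobarGen (σ.face i.succ.castSucc) := rfl
    rw [cubeGen_eq (by omega), cubeGen_eq (by omega), cubeGen_eq (by omega), hF, hB, hface]
    have h1 : ((i : ℕ) + 1 = 1) = (i = 0) := by
      simp only [Fin.ext_iff, Fin.val_zero, eq_iff_iff]; omega
    have h2 : (k + 1 - (i : ℕ) = 1) = (i = Fin.last k) := by
      simp only [Fin.ext_iff, Fin.val_last, eq_iff_iff]; omega
    have h3 : (k + 1 = 1) = (i = 0 ∧ i = Fin.last k) := by
      simp only [Fin.ext_iff, Fin.val_last, eq_iff_iff, Fin.val_zero]; omega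
    have hB0 : i = 0 → cobarGen (σ.back (p := i + 1) (q := k - i + 1) (by omega)) =
        cobarGen (σ.face 0) := by
      rintro rfl
      refine pull_congr (p := k - 0 + 1) (p' := k + 1) cobarGen' rfl σ
        (fun j => ⟨0 + 1 + j, by omega⟩) (Fin.succAbove 0) (fun i _ _ => ?_)
      simp [add_comm]
    have hFl : i = Fin.last k → cobarGen (σ.front (p := i + 1) (q := k - i + 1) (by omega)) =
        cobarGen (σ.face (Fin.last _)) := by
      rintro rfl
      refine pull_congr (p := k + 1) (p' := k + 1) cobarGen' rfl σ
        (fun j => ⟨j, by omega⟩) (Fin.succAbove (Fin.last _)) (fun i _ _ => ?_)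
      simp
    simp only [h1, h2, h3]
    by_cases c0 : i = 0 <;> by_cases cl : i = Fin.last k
    · have hk : k = 0 := by
        rw [c0] at cl; simpa [Fin.ext_iff] using cl.symm
      rw [if_pos ⟨c0, cl⟩, if_pos c0, if_pos cl, if_pos c0, if_pos cl, hB0 c0, hFl cl]
      have hs : (-1 : ℚ) ^ (i : ℕ) = 1 := by simp [c0]
      have hs' : (-1 : ℚ) ^ k = 1 := by simp [hk]
      rw [hs, hs']
      simp only [one_smul]
      noncomm_ring
    · rw [if_neg (by tauto), if_pos c0, if_neg cl, if_pos c0, if_neg cl, hB0 c0]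
      have hs : (-1 : ℚ) ^ (i : ℕ) = 1 := by simp [c0]
      rw [hs]
      simp only [one_smul]
      noncomm_ring
    · rw [if_neg (by tauto), if_neg c0, if_pos cl, if_neg c0, if_pos cl, hFl cl]
      have hs : (-1 : ℚ) ^ (i : ℕ) = (-1 : ℚ) ^ k := by simp [cl]
      rw [hs, ← smul_sub, sub_zero, ← smul_sub]
      congr 1
      noncomm_ring
    · rw [if_neg (by tauto), if_neg c0, if_neg cl, if_neg c0, if_neg cl]
      simp [smul_sub]
  rw [Finset.sum_congr rfl fun i _ => e i]
  simp only [Finset.sum_sub_distrib, Finset.sum_ite_eq', Finset.mem_univ, if_true]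
  have h : cobarD X b (cubeGen σ) = cobarD X b (cobarGen σ) := rfl
  rw [h, cobarD_gen_succ, Fin.sum_univ_succ, Fin.sum_univ_castSucc]
  simp only [pow_succ, mul_neg, mul_one, neg_smul, Finset.sum_neg_distrib, Fin.val_zero, pow_zero,
    one_smul, Fin.val_succ, Fin.val_castSucc, Fin.val_last, Fin.succ_last, Fin.succ_castSucc,
    neg_neg]
  abel

/-- `cubeGen` of the face of `σ` with vertices `f 0, …, f p`. -/
def faceGen {N : ℕ} (σ : PSimplex X b N) (p : ℕ) (f : ℕ → ℕ) : Cobar X b :=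
  cubeGen (σ.pull fun i : Fin (p + 1) => Fin.ofNat (N + 1) (f i))

lemma faceGen_congr {N : ℕ} (σ : PSimplex X b N) {p : ℕ} {f g : ℕ → ℕ}
    (h : ∀ k ≤ p, f k = g k) : faceGen σ p f = faceGen σ p g := by
  unfold faceGen
  congr 2
  funext i
  rw [h i (by omega)]

lemma faceGen_id {N : ℕ} (σ : PSimplex X b N) : faceGen σ N id = cubeGen σ := by
  unfold faceGen
  congr 1
  convert PSimplex.pull_id σ using 2
  funext i
  simp

lemma faceGen_mem {N : ℕ} (σ : PSimplex X b N) (p : ℕ) (f : ℕ → ℕ) :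
    faceGen σ p f ∈ cobarGr X b (p - 1) := cubeGen_mem _

/-- The map `ℕ → ℕ` that skips `i`. -/
def skip (i k : ℕ) : ℕ := if k < i then k else k + 1

lemma cobarD_faceGen {N : ℕ} (σ : PSimplex X b N) (p : ℕ) (f : ℕ → ℕ) :
    cobarD X b (faceGen σ p f) = ∑ i ∈ Finset.range (p - 1), (-1 : ℚ) ^ i •
      (faceGen σ (p - 1) (f ∘ skip (i + 1)) -
        faceGen σ (i + 1) f * faceGen σ (p - 1 - i) (fun k => f (i + 1 + k))) := by
  rcases p with _ | m
  · have : cobarD X b 1 = 0 := TA.deriv_one _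
    simpa [faceGen, cubeGen] using this
  rw [faceGen, cobarD_cubeGen, Nat.add_sub_cancel, ← Fin.sum_univ_eq_sum_range (fun i =>
    (-1 : ℚ) ^ i • (faceGen σ m (f ∘ skip (i + 1)) -
        faceGen σ (i + 1) f * faceGen σ (m - i) (fun k => f (i + 1 + k))))]
  refine Finset.sum_congr rfl fun i _ => ?_
  congr 2
  · rw [PSimplex.face, PSimplex.pull_pull, faceGen]
    congr 2
    funext k
    simp only [Function.comp, skip, Fin.succAbove, Fin.lt_def, Fin.val_castSucc, Fin.val_succ]
    split_ifs <;> rfl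
  · rw [PSimplex.front, PSimplex.pull_pull, PSimplex.back, PSimplex.pull_pull]
    rfl

lemma sum_sum_alternating {W : Type*} [AddCommGroup W] [Module ℚ W] (P : ℕ) (K : ℕ → ℕ → W)
    (h : ∀ i j, i ≤ j → j < P → K i j = K (j + 1) i) :
    ∑ i ∈ Finset.range (P + 1), ∑ j ∈ Finset.range P, (-1 : ℚ) ^ (i + j) • K i j = 0 := by
  rw [← Finset.sum_product', ← Finset.sum_filter_add_sum_filter_not _ (fun x => x.1 ≤ x.2),
    add_eq_zero_iff_eq_neg, ← Finset.sum_neg_distrib]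
  refine Finset.sum_bij' (fun x _ => (x.2 + 1, x.1)) (fun x _ => (x.2, x.1 - 1)) ?_ ?_ ?_ ?_ ?_
  · rintro ⟨i, j⟩ hx
    simp only [Finset.mem_filter, Finset.mem_product, Finset.mem_range] at hx ⊢
    omega
  · rintro ⟨i, j⟩ hx
    simp only [Finset.mem_filter, Finset.mem_product, Finset.mem_range] at hx ⊢
    omega
  · rintro ⟨i, j⟩ hx
    simp
  · rintro ⟨i, j⟩ hx
    simp only [Finset.mem_filter, Finset.mem_product, Finset.mem_range] at hx
    simp only [Prod.mk.injEq, and_true]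
    omega
  · rintro ⟨i, j⟩ hx
    simp only [Finset.mem_filter, Finset.mem_product, Finset.mem_range] at hx
    simp only
    rw [h i j hx.2 hx.1.2, show j + 1 + i = i + j + 1 by omega, pow_succ]
    simp

/-- The two-fold faces of a cube of paths. -/
def faceFace {N : ℕ} (σ : PSimplex X b N) (P : ℕ) (f : ℕ → ℕ) (i j : ℕ) : Cobar X b :=
  faceGen σ P (f ∘ skip (i + 1) ∘ skip (j + 1)) -
    faceGen σ (j + 1) (f ∘ skip (i + 1)) *
      faceGen σ (P - j) (fun k => f (skip (i + 1) (j + 1 + k))) -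
    if j < i then
      (faceGen σ i (f ∘ skip (j + 1)) -
        faceGen σ (j + 1) f * faceGen σ (i - j) (fun k => f (j + 1 + k))) *
          faceGen σ (P + 1 - i) (fun k => f (i + 1 + k))
    else
      faceGen σ (i + 1) f *
        (faceGen σ (P - i) (fun k => f (i + 1 + skip (j - i + 1) k)) -
          faceGen σ (j - i + 1) (fun k => f (i + 1 + k)) *
            faceGen σ (P - j) (fun k => f (j + 2 + k)))

lemma faceFace_symm {N : ℕ} (σ : PSimplex X b N) (P : ℕ) (f : ℕ → ℕ) (i j : ℕ) (hij : i ≤ j)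
    (hj : j < P) : faceFace σ P f i j = faceFace σ P f (j + 1) i := by
  rw [faceFace, faceFace, if_neg (by omega), if_pos (by omega)]
  have e1 : f ∘ skip (i + 1) ∘ skip (j + 1) = f ∘ skip (j + 1 + 1) ∘ skip (i + 1) := by
    funext k
    simp only [Function.comp, skip]
    congr 1
    split_ifs <;> omega
  have e2 : (fun k => f (skip (i + 1) (j + 1 + k))) = fun k => f (j + 1 + 1 + k) := by
    funext k
    congr 1
    simp only [skip]
    split_ifs <;> omega
  have e3 : faceGen σ (i + 1) (f ∘ skip (j + 1 + 1)) = faceGen σ (i + 1) f :=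
    faceGen_congr σ fun k hk => by
      simp only [Function.comp, skip]; rw [if_pos (by omega)]
  have e4 : (fun k => f (skip (j + 1 + 1) (i + 1 + k))) =
      fun k => f (i + 1 + skip (j - i + 1) k) := by
    funext k
    congr 1
    simp only [skip]
    split_ifs <;> omega
  rw [e1, e2, e3, e4, show P + 1 - (j + 1) = P - j by omega, show j + 1 - i = j - i + 1 by omega]
  noncomm_ring

lemma cobarD_cobarD_faceGen {N : ℕ} (σ : PSimplex X b N) (P : ℕ) (f : ℕ → ℕ) :
    cobarD X b (cobarD X b (faceGen σ (P + 2) f)) = 0 := by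
  rw [← sum_sum_alternating P (faceFace σ P f) (faceFace_symm σ P f), cobarD_faceGen]
  simp only [map_sum, map_smul, map_sub]
  refine Finset.sum_congr rfl fun i hi => ?_
  rw [Finset.mem_range] at hi
  have hi : i ≤ P := by omega
  simp only [pow_add, mul_smul, ← Finset.smul_sum]
  congr 1
  rw [cobarD, TA.deriv_mul, ← cobarD, TA.parity_of_mem (faceGen_mem σ (i + 1) f),
    cobarD_faceGen, cobarD_faceGen, cobarD_faceGen]
  simp only [Nat.add_sub_cancel, show P + 2 - 1 - i - 1 = P - i by omega,
    show P + 2 - 1 - 1 = P by omega]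
  have hsplit : ∀ g : ℕ → Cobar X b, ∑ j ∈ Finset.range P, g j =
      ∑ j ∈ Finset.range i, g j + ∑ j ∈ Finset.range (P - i), g (i + j) := by
    intro g
    rw [← Finset.sum_range_add_sum_Ico g hi, Finset.sum_Ico_eq_sum_range]
  rw [hsplit, hsplit]
  have e1 : ∀ j ∈ Finset.range i, (-1 : ℚ) ^ j • faceFace σ P f i j =
      (-1 : ℚ) ^ j • (faceGen σ P ((f ∘ skip (i + 1)) ∘ skip (j + 1)) -
        faceGen σ (j + 1) (f ∘ skip (i + 1)) *
          faceGen σ (P - j) (fun k => (f ∘ skip (i + 1)) (j + 1 + k))) -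
      ((-1 : ℚ) ^ j • (faceGen σ i (f ∘ skip (j + 1)) -
        faceGen σ (j + 1) f * faceGen σ (i - j) (fun k => f (j + 1 + k)))) *
          faceGen σ (P + 2 - 1 - i) (fun k => f (i + 1 + k)) := by
    intro j hj
    rw [faceFace, if_pos (Finset.mem_range.1 hj), smul_sub, smul_mul_assoc]
    rfl
  have e2 : ∀ j ∈ Finset.range (P - i), (-1 : ℚ) ^ (i + j) • faceFace σ P f i (i + j) =
      (-1 : ℚ) ^ (i + j) • (faceGen σ P ((f ∘ skip (i + 1)) ∘ skip (i + j + 1)) -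
        faceGen σ (i + j + 1) (f ∘ skip (i + 1)) *
          faceGen σ (P - (i + j)) (fun k => (f ∘ skip (i + 1)) (i + j + 1 + k))) -
      ((-1 : ℚ) ^ i • faceGen σ (i + 1) f) * ((-1 : ℚ) ^ j •
        (faceGen σ (P - i) ((fun k => f (i + 1 + k)) ∘ skip (j + 1)) -
          faceGen σ (j + 1) (fun k => f (i + 1 + k)) *
            faceGen σ (P - i - j) (fun k => f (i + 1 + (j + 1 + k))))) := by
    intro j _
    rw [faceFace, if_neg (by omega), smul_sub, smul_mul_smul_comm, ← pow_add,
      show i + j - i = j by omega, show P - (i + j) = P - i - j by omega]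
    simp only [show ∀ k, i + j + 2 + k = i + 1 + (j + 1 + k) by omega]
    rfl
  rw [Finset.sum_congr rfl e1, Finset.sum_congr rfl e2, Finset.sum_sub_distrib,
    Finset.sum_sub_distrib, ← Finset.sum_mul, ← Finset.mul_sum]
  abel

end Cobar

section TAaux

variable {M : ℕ → Type u} [∀ n, AddCommGroup (M n)] [∀ n, Module ℚ (M n)]

lemma TA.kills_pos {W : Type*} [Ring W] [Algebra ℚ W] (f : TA M →ₐ[ℚ] W)
    (h : ∀ n x, f (TA.gen (n + 1) x) = 0) {k : ℕ} {x : TA M} (hx : x ∈ TA.gr M (k + 1)) :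
    f x = 0 := by
  have key : ∀ l : List (Σ n, M n), 0 < (l.map Sigma.fst).sum →
      f (l.map fun p => TA.gen p.1 p.2).prod = 0 := by
    intro l
    induction l with
    | nil => simp
    | cons p l ih =>
      obtain ⟨n, x⟩ := p
      intro hl
      simp only [List.map_cons, List.prod_cons, List.sum_cons, map_mul] at hl ⊢
      rcases n with _ | n
      · rw [ih (by omega), mul_zero]
      · rw [h, zero_mul]
  induction hx using Submodule.span_induction with
  | zero => simp
  | add x y hx hy ihx ihy => rw [map_add, ihx, ihy, add_zero]
  | smul r x hx ih => rw [map_smul, ih, smul_zero]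
  | mem x hx => obtain ⟨l, hl, rfl⟩ := hx; exact key l (by omega)

end TAaux

section Cobar

variable {X : Type u} [TopologicalSpace X] {b : X}

lemma cobarDGen_mem (n : ℕ) (x : NChain X b (n + 2)) :
    cobarDGen (n + 1) x ∈ cobarGr X b n := by
  simp only [cobarDGen, LinearMap.add_apply, LinearMap.neg_apply, LinearMap.comp_apply,
    LinearMap.sum_apply, LinearMap.smul_apply]
  refine add_mem (neg_mem (TA.gen_mem _)) (sum_mem fun i _ => Submodule.smul_mem _ _ ?_)
  have key : ∀ t : NChain X b (i + 1) ⊗[ℚ] NChain X b (n - i + 1),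
      LinearMap.mul' ℚ (Cobar X b) (TensorProduct.map
        (TA.gen (M := fun n => NChain X b (n + 1)) (i : ℕ))
        (TA.gen (M := fun n => NChain X b (n + 1)) (n - i)) t) ∈ cobarGr X b n := by
    intro t
    induction t using TensorProduct.induction_on with
    | zero => simp
    | tmul x y =>
      have := SetLike.mul_mem_graded (A := cobarGr X b)
        (TA.gen_mem (M := fun n => NChain X b (n + 1)) x)
        (TA.gen_mem (M := fun n => NChain X b (n + 1)) y)
      rw [show (i : ℕ) + (n - i) = n by omega] at this
      simpa using this
    | add x y hx hy => simpa only [map_add] using add_mem hx hy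
  exact key _

lemma cobarD_cobarD_gen {n : ℕ} (σ : PSimplex X b (n + 1)) :
    cobarD X b (cobarD X b (cobarGen σ)) = 0 := by
  rcases n with _ | P
  · rw [cobarD_gen_zero, map_zero]
  · have : cobarGen σ = faceGen σ (P + 2) id := (faceGen_id σ).symm
    rw [this, cobarD_cobarD_faceGen]

/-- The cobar construction is a differential graded algebra. -/
instance : IsDGAlgebra (cobarGr X b) (cobarD X b) where
  d_mem {n a} h := (TA.deriv_mem cobarDGen rfl cobarDGen_mem).2 n a h
  d_zero {a} h := (TA.deriv_mem cobarDGen rfl cobarDGen_mem).1 a h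
  leibniz {n a} c h := by
    rw [cobarD, TA.deriv_mul, TA.parity_of_mem h, smul_mul_assoc]
  d_d a := by
    refine TA.deriv_deriv cobarDGen ?_ ?_ a
    · intro n x
      rcases n with _ | n
      · simp [cobarDGen]
      · rw [TA.parity_of_mem (cobarDGen_mem n x), pow_succ]
        simp
    · intro n x
      have : (cobarD X b ∘ₗ cobarDGen n) = 0 := NChain.hom_ext fun σ => by
        have := cobarD_cobarD_gen σ
        rw [cobarGen] at this
        nth_rewrite 2 [cobarD] at this
        rw [TA.deriv_gen] at this
        exact this
      exact LinearMap.congr_fun this x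

lemma cobar_hom_ext {W : Type*} [Ring W] [Algebra ℚ W] {f g : Cobar X b →ₐ[ℚ] W}
    (h : ∀ n (σ : PSimplex X b (n + 1)), f (cobarGen σ) = g (cobarGen σ)) : f = g := by
  refine TA.hom_ext fun n x => ?_
  have : f.toLinearMap ∘ₗ TA.gen (M := fun n => NChain X b (n + 1)) n =
    g.toLinearMap ∘ₗ TA.gen (M := fun n => NChain X b (n + 1)) n :=
      NChain.hom_ext fun σ => h n σ
  exact LinearMap.congr_fun this x

lemma gen_eq_zero_of {W : Type*} [Ring W] [Algebra ℚ W] (f : Cobar X b →ₐ[ℚ] W) {n : ℕ}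
    (h : ∀ σ : PSimplex X b (n + 1), f (cobarGen σ) = 0) (x : NChain X b (n + 1)) :
    f (TA.gen (M := fun n => NChain X b (n + 1)) n x) = 0 := by
  have : f.toLinearMap ∘ₗ TA.gen (M := fun n => NChain X b (n + 1)) n = 0 :=
      NChain.hom_ext fun σ => h σ
  exact LinearMap.congr_fun this x

lemma cobar_kills_pos {W : Type*} [Ring W] [Algebra ℚ W] (f : Cobar X b →ₐ[ℚ] W)
    (h : ∀ n (σ : PSimplex X b (n + 2)), f (cobarGen σ) = 0) {k : ℕ} {x : Cobar X b}
    (hx : x ∈ cobarGr X b (k + 1)) : f x = 0 :=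
  TA.kills_pos f (fun n x => gen_eq_zero_of f (n := n + 1) (h n) x) hx

/-- An algebra map which vanishes in positive degrees and is compatible with all `2`-simplices
vanishes on boundaries. -/
lemma comp_cobarD_eq_zero {W : Type*} [Ring W] [Algebra ℚ W] (f : Cobar X b →ₐ[ℚ] W)
    (h₀ : ∀ n (σ : PSimplex X b (n + 2)), f (cobarGen σ) = 0)
    (h₁ : ∀ σ : PSimplex X b 2, f (cubeGen (σ.face 1)) =
      f (cubeGen (σ.front (p := 1) (q := 1) rfl)) * f (cubeGen (σ.back (p := 1) (q := 1) rfl)))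
    (x : Cobar X b) : f (cobarD X b x) = 0 := by
  induction x using TA.induction_gen with
  | halg r => simp [cobarD]
  | hmul x y hx hy =>
    rw [cobarD, TA.deriv_mul, ← cobarD, map_add, map_mul, map_mul, hx, hy, zero_mul, mul_zero,
      add_zero]
  | hadd x y hx hy => rw [map_add, map_add, hx, hy, add_zero]
  | hgen n x =>
    have : f.toLinearMap ∘ₗ cobarD X b ∘ₗ TA.gen (M := fun n => NChain X b (n + 1)) n = 0 := by
      refine NChain.hom_ext fun σ => ?_
      change f (cobarD X b (cobarGen σ)) = 0
      rcases n with _ | _ | n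
      · rw [cobarD_gen_zero, map_zero]
      · change f (cobarD X b (cubeGen σ)) = 0
        rw [cobarD_cubeGen]
        simp only [Fin.sum_univ_one, Fin.val_zero, pow_zero, one_smul, map_sub, map_mul]
        exact sub_eq_zero.2 (h₁ σ)
      · exact cobar_kills_pos f h₀
          (IsDGAlgebra.d_mem (𝒜 := cobarGr X b) (d := cobarD X b) (cobarGen_mem σ))
    exact LinearMap.congr_fun this x

/-- The augmentation of the cobar construction: the projection onto tensors of length zero. -/
def cobarAug (X : Type u) [TopologicalSpace X] (b : X) : Cobar X b →ₐ[ℚ] ℚ :=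
  TA.lift fun _ => 0

@[simp] lemma cobarAug_gen {n : ℕ} (σ : PSimplex X b (n + 1)) : cobarAug X b (cobarGen σ) = 0 := by
  simp [cobarAug, cobarGen]

/-- The zeroth homology algebra of the cobar construction. -/
abbrev H0Cobar (X : Type u) [TopologicalSpace X] (b : X) : Type u :=
  H0 (cobarGr X b) (cobarD X b)

/-- The projection of the cobar construction onto its degree zero part, followed by the projection
onto homology. -/
def cobarPi (X : Type u) [TopologicalSpace X] (b : X) : Cobar X b →ₐ[ℚ] H0Cobar X b :=
  TA.lift fun n => match n with
    | 0 => (H0.mk (cobarGr X b) (cobarD X b)).toLinearMap ∘ₗ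
        (TA.gen (M := fun n => NChain X b (n + 1)) 0).codRestrict
          (Subalgebra.toSubmodule (cycles₀ (cobarGr X b) (cobarD X b)))
          (fun x => (cycle (cobarGr X b) (cobarD X b) _ (TA.gen_mem (M := fun n => NChain X b (n + 1)) (n := 0) x)).2)
    | _ + 1 => 0

lemma cobarPi_of_pos {n : ℕ} {x : Cobar X b} (hx : x ∈ cobarGr X b (n + 1)) :
    cobarPi X b x = 0 :=
  TA.kills_pos _ (fun n x => by simp [cobarPi]) hx

lemma cobarPi_cycle (z : cycles₀ (cobarGr X b) (cobarD X b)) :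
    cobarPi X b z = H0.mk (cobarGr X b) (cobarD X b) z := by
  have key : ∀ (x : Cobar X b) (hx : x ∈ cobarGr X b 0), cobarPi X b x =
      H0.mk (cobarGr X b) (cobarD X b) (cycle (cobarGr X b) (cobarD X b) x hx) := by
    intro x hx
    induction hx using Submodule.span_induction with
    | zero => rw [map_zero]; exact (map_zero (H0.mk (cobarGr X b) (cobarD X b))).symm
    | add x y hx hy ihx ihy =>
      rw [map_add, ihx, ihy]; exact (map_add (H0.mk (cobarGr X b) (cobarD X b)) _ _).symm
    | smul r x hx ih =>
      rw [map_smul, ih]; exact (map_smul (H0.mk (cobarGr X b) (cobarD X b)) _ _).symm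
    | mem x hx =>
      obtain ⟨l, hl, rfl⟩ := hx
      induction l with
      | nil =>
        simp only [List.map_nil, List.prod_nil, map_one]
        exact (map_one (H0.mk (cobarGr X b) (cobarD X b))).symm
      | cons p l ih =>
        obtain ⟨n, x⟩ := p
        simp only [List.map_cons, List.sum_cons] at hl
        obtain ⟨rfl, hl'⟩ : n = 0 ∧ (l.map Sigma.fst).sum = 0 := by omega
        simp only [List.map_cons, List.prod_cons, map_mul]
        rw [ih hl']
        have : cobarPi X b (TA.gen (M := fun n => NChain X b (n + 1)) 0 x) =
          H0.mk (cobarGr X b) (cobarD X b)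
            (cycle (cobarGr X b) (cobarD X b) _ (TA.gen_mem (M := fun n => NChain X b (n + 1)) (n := 0) x)) := by
          rw [cobarPi, TA.lift_gen]; rfl
        rw [this]
        exact (map_mul (H0.mk (cobarGr X b) (cobarD X b)) _ _).symm
  exact key z z.2.1

/-- The class of `1 + [σ]` for a pointed `1`-simplex `σ`. -/
def edge (σ : PSimplex X b 1) : H0Cobar X b :=
  H0.mk (cobarGr X b) (cobarD X b)
    (cycle (cobarGr X b) (cobarD X b) (cubeGen σ) (cubeGen_mem σ))

lemma cobarPi_cubeGen (σ : PSimplex X b 1) : cobarPi X b (cubeGen σ) = edge σ :=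
  cobarPi_cycle (cycle (cobarGr X b) (cobarD X b) (cubeGen σ) (cubeGen_mem σ))

lemma H0Cobar.hom_ext {W : Type*} [Ring W] [Algebra ℚ W] {f g : H0Cobar X b →ₐ[ℚ] W}
    (h : ∀ σ : PSimplex X b 1, f (edge σ) = g (edge σ)) : f = g := by
  have : f.comp (cobarPi X b) = g.comp (cobarPi X b) := by
    refine cobar_hom_ext fun n σ => ?_
    simp only [AlgHom.comp_apply]
    rcases n with _ | n
    · have := h σ
      rw [← cobarPi_cubeGen, cubeGen] at this
      simpa using this
    · rw [cobarPi_of_pos (cobarGen_mem σ), map_zero, map_zero]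
  ext x
  obtain ⟨z, rfl⟩ := H0.mk_surjective _ _ x
  rw [← cobarPi_cycle]
  exact AlgHom.congr_fun this (z : Cobar X b)

lemma edge_face (σ : PSimplex X b 2) : edge (σ.face 1) =
    edge (σ.front (p := 1) (q := 1) rfl) * edge (σ.back (p := 1) (q := 1) rfl) := by
  rw [edge, edge, edge, ← map_mul, ← sub_eq_zero, ← map_sub, H0.mk_eq_zero]
  refine ⟨cubeGen σ, cubeGen_mem σ, ?_⟩
  rw [cobarD_cubeGen]
  simp only [Fin.sum_univ_one, Fin.val_zero, pow_zero, one_smul]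
  rfl

end Cobar

section Coproduct

variable {X : Type u} [TopologicalSpace X] {b : X}

/-- For a composition `c` of `n`, the face of `σ` spanned by the end points of the blocks. -/
def PSimplex.outer {n : ℕ} (σ : PSimplex X b n) (c : Composition n) : PSimplex X b c.length :=
  σ.pull c.boundary

/-- For a composition `c` of `n`, the face of `σ` spanned by the consecutive vertices of the `i`-th
block, end points included. -/
def PSimplex.block {n : ℕ} (σ : PSimplex X b n) (c : Composition n) (i : Fin c.length) :
    PSimplex X b (c.blocksFun i) :=
  σ.pull fun k => ⟨c.sizeUpTo i + k, by
    have h₁ := c.sizeUpTo_succ' i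
    have h₂ := c.sizeUpTo_le (i + 1)
    have h₃ := k.2
    omega⟩

/-- The summand of the cubical diagonal of `σ` given by the composition with end points
`0 = b₀ < b₁ < ⋯ < b_k = n`: up to the sign of the corresponding shuffle, it is the tensor product
of the outer face and the concatenation of the blocks. -/
def nablaTerm {n : ℕ} (σ : PSimplex X b n) (c : Composition n) :
    cobarGr X b ᵍ⊗[ℚ] cobarGr X b :=
  (-1 : ℚ) ^ (∑ j ∈ Finset.range c.length, (c.sizeUpTo j - j)) •
    GradedTensorProduct.tmul ℚ (cubeGen (σ.outer c))
      (List.ofFn fun i : Fin c.length => cubeGen (σ.block c i)).prod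

lemma nablaTerm_eq_zero {n : ℕ} {σ : PSimplex X b (n + 2)} (h : σ.IsDegenerate)
    (c : Composition (n + 2)) : nablaTerm σ c = 0 := by
  obtain ⟨j, τ, rfl⟩ := h
  have hlen : 0 < c.length := c.length_pos_iff.2 (by omega)
  set i := c.index j with hi
  have h₁ : (j : ℕ) < c.sizeUpTo (i + 1) := c.lt_sizeUpTo_index_succ j
  have h₂ : c.sizeUpTo i ≤ j := c.sizeUpTo_index_le j
  have h₃ := c.sizeUpTo_succ' i
  by_cases hb : 2 ≤ c.blocksFun i
  · have : cubeGen ((τ.degen j).block c i) = 0 := by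
      refine cubeGen_eq_zero hb ?_
      have key : ∀ {m : ℕ} (f : Fin (m + 1) → Fin (n + 2 + 1)) (_ : 2 ≤ m)
          (k : ℕ) (_ : k + 1 < m + 1), (∀ (l : ℕ) (hl : l < m + 1), (f ⟨l, hl⟩ : ℕ) = c.sizeUpTo i + l) →
          c.sizeUpTo i + k = j → ((τ.degen j).pull f).IsDegenerate := by
        intro m f hm k hk hf hkj
        obtain ⟨m, rfl⟩ : ∃ m', m = m' + 1 := ⟨m - 1, by omega⟩
        refine PSimplex.isDegenerate_degen_pull τ j f ⟨k, by omega⟩ ?_ ?_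
        · refine Fin.ext ((hf k (by omega)).trans ?_)
          simpa using hkj
        · refine Fin.ext ((hf (k + 1) (by omega)).trans ?_)
          simp only [Fin.val_succ]; omega
      exact key _ hb (j - c.sizeUpTo i) (by omega) (fun _ _ => rfl) (by omega)
    rw [nablaTerm, List.prod_eq_zero (List.mem_ofFn.2 ⟨i, this⟩), GradedTensorProduct.tmul,
      TensorProduct.tmul_zero, map_zero,
      smul_zero]
  · have h1 : c.blocksFun i = 1 := le_antisymm (by omega) (c.one_le_blocksFun i)
    have hlen2 : 2 ≤ c.length := by
      by_contra hcon
      have hl : c.length = 1 := by omega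
      have hi0 : (i : ℕ) = 0 := by omega
      have h4 : c.sizeUpTo (i + 1) = n + 2 := c.sizeUpTo_ofLength_le _ (by omega)
      have h5 : c.sizeUpTo i = 0 := by rw [hi0, c.sizeUpTo_zero]
      omega
    have : cubeGen ((τ.degen j).outer c) = 0 := by
      refine cubeGen_eq_zero hlen2 ?_
      have key : ∀ {m : ℕ} (f : Fin (m + 1) → Fin (n + 2 + 1)) (_ : 2 ≤ m)
          (k : ℕ) (_ : k + 1 < m + 1), (∀ (l : ℕ) (hl : l < m + 1), (f ⟨l, hl⟩ : ℕ) = c.sizeUpTo l) →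
          c.sizeUpTo k = j → c.sizeUpTo (k + 1) = j + 1 → ((τ.degen j).pull f).IsDegenerate := by
        intro m f hm k hk hf hkj hkj'
        obtain ⟨m, rfl⟩ : ∃ m', m = m' + 1 := ⟨m - 1, by omega⟩
        refine PSimplex.isDegenerate_degen_pull τ j f ⟨k, by omega⟩ ?_ ?_
        · refine Fin.ext ((hf k (by omega)).trans ?_)
          simpa using hkj
        · refine Fin.ext ((hf (k + 1) (by omega)).trans ?_)
          simpa using hkj'
      exact key _ hlen2 i (by omega) (fun _ _ => rfl) (by omega) (by omega)
    rw [nablaTerm, this, GradedTensorProduct.tmul, TensorProduct.zero_tmul, map_zero, smul_zero]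

/-- The only summand for a `1`-simplex. -/
lemma nablaTerm_one (σ : PSimplex X b 1) (c : Composition 1) :
    nablaTerm σ c = GradedTensorProduct.tmul ℚ (cubeGen σ) (cubeGen σ) := by
  have hl : c.length = 1 := le_antisymm c.length_le (c.length_pos_iff.2 one_pos)
  have hs : ∀ i ≤ 1, c.sizeUpTo i = i := by
    intro i hi
    obtain rfl | rfl : i = 0 ∨ i = 1 := by omega
    · exact c.sizeUpTo_zero
    · exact c.sizeUpTo_ofLength_le 1 hl.le
  have h₁ : cubeGen (σ.outer c) = cubeGen σ :=
    (pull_congr cubeGen hl σ c.boundary id fun i hi _ => hs i (by omega)).trans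
      (congrArg cubeGen σ.pull_id)
  have h₂ : (List.ofFn fun i : Fin c.length => cubeGen (σ.block c i)).prod = cubeGen σ := by
    have : ∀ i : Fin c.length, cubeGen (σ.block c i) = cubeGen σ := fun i => by
      have hi : (i : ℕ) = 0 := by omega
      have hb : c.blocksFun i = 1 := le_antisymm (c.blocksFun_le i) (c.one_le_blocksFun i)
      refine (pull_congr cubeGen hb σ _ id fun k hk _ => ?_).trans (congrArg cubeGen σ.pull_id)
      simp [hi]
    simp only [this, List.ofFn_const, List.prod_replicate, hl, pow_one]
  rw [nablaTerm, h₁, h₂, hl]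
  simp

/-- The coproduct on generators: the sum over all compositions, corrected by `1 ⊗ 1` for
`1`-simplices because `[σ] = cubeGen σ - 1` for them. -/
def nablaGen (n : ℕ) : NChain X b (n + 1) →ₗ[ℚ] cobarGr X b ᵍ⊗[ℚ] cobarGr X b :=
  NChain.lift (fun σ => (∑ c : Composition (n + 1), nablaTerm σ c) - if n = 0 then 1 else 0) <| by
    intro σ h
    rcases n with _ | n
    · have h0 : cubeGen σ = 1 := by rw [cubeGen, cobarGen_eq_zero h, add_zero]
      have hu : Fintype.card (Composition (0 + 1)) = 1 := by rw [composition_card]; rfl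
      rw [Finset.sum_congr rfl fun c _ => nablaTerm_one σ c, Finset.sum_const, Finset.card_univ, hu,
        h0, one_smul, if_pos rfl, sub_eq_zero]
      rfl
    · rw [Finset.sum_eq_zero fun c _ => nablaTerm_eq_zero h c]
      simp

/-- The coproduct `∇` of the cobar construction, obtained from the diagonal of the cubes of paths:
an algebra map to the graded tensor product. -/
def nabla (X : Type u) [TopologicalSpace X] (b : X) :
    Cobar X b →ₐ[ℚ] cobarGr X b ᵍ⊗[ℚ] cobarGr X b :=
  TA.lift nablaGen

lemma nabla_gen_zero (σ : PSimplex X b 1) : nabla X b (cubeGen σ) =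
    GradedTensorProduct.tmul ℚ (cubeGen σ) (cubeGen σ) := by
  have hu : Fintype.card (Composition (0 + 1)) = 1 := by rw [composition_card]; rfl
  rw [cubeGen, map_add, map_one, nabla, cobarGen, TA.lift_gen, nablaGen, NChain.lift_of, ← cobarGen,
    Finset.sum_congr rfl fun c _ => nablaTerm_one σ c, Finset.sum_const, Finset.card_univ, hu]
  simp [cubeGen]

/-- `π ⊗ π` for the projection `π` from the cobar construction to its homology in degree zero. -/
def cobarPiPi (X : Type u) [TopologicalSpace X] (b : X) :
    cobarGr X b ᵍ⊗[ℚ] cobarGr X b →ₐ[ℚ] H0Cobar X b ⊗[ℚ] H0Cobar X b :=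
  GradedTensorProduct.lift _ _
    (Algebra.TensorProduct.includeLeft.comp (cobarPi X b))
    (Algebra.TensorProduct.includeRight.comp (cobarPi X b)) <| by
      rintro i j ⟨x, hx⟩ ⟨y, hy⟩
      rcases i with _ | i
      · simp
      · simp [cobarPi_of_pos hx]

lemma cobarPiPi_tmul (x y : Cobar X b) :
    cobarPiPi X b (GradedTensorProduct.tmul ℚ x y) = cobarPi X b x ⊗ₜ[ℚ] cobarPi X b y := by
  simp [cobarPiPi]

lemma cobarPiPi_nabla_cubeGen (σ : PSimplex X b 1) :
    cobarPiPi X b (nabla X b (cubeGen σ)) = edge σ ⊗ₜ[ℚ] edge σ := by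
  rw [nabla_gen_zero, cobarPiPi_tmul, cobarPi_cubeGen]

lemma cobarPiPi_nabla_gen {n : ℕ} (σ : PSimplex X b (n + 2)) :
    cobarPiPi X b (nabla X b (cobarGen σ)) = 0 := by
  rw [nabla, cobarGen, TA.lift_gen, nablaGen, NChain.lift_of, if_neg (by omega), sub_zero, map_sum]
  refine Finset.sum_eq_zero fun c _ => ?_
  rw [nablaTerm, map_smul, cobarPiPi_tmul]
  have hlen : 0 < c.length := c.length_pos_iff.2 (by omega)
  by_cases h : 2 ≤ c.length
  · have := cubeGen_mem (σ.outer c)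
    obtain ⟨k, hk⟩ : ∃ k, c.length - 1 = k + 1 := ⟨c.length - 2, by omega⟩
    rw [hk] at this
    rw [cobarPi_of_pos this, TensorProduct.zero_tmul, smul_zero]
  · have hl : c.length = 1 := by omega
    have h0 : cobarPi X b (cubeGen (σ.block c ⟨0, hlen⟩)) = 0 := by
      have hm := cubeGen_mem (σ.block c ⟨0, hlen⟩)
      have hs := c.sizeUpTo_succ' ⟨0, hlen⟩
      simp only [c.sizeUpTo_zero, zero_add] at hs
      have := c.sizeUpTo_length
      rw [hl] at this
      have hk : c.blocksFun ⟨0, hlen⟩ - 1 = n + 1 := by omega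
      rw [hk] at hm
      exact cobarPi_of_pos hm
    rw [map_list_prod, List.prod_eq_zero, TensorProduct.tmul_zero, smul_zero]
    rw [List.mem_map]
    exact ⟨_, List.mem_ofFn.2 ⟨⟨0, hlen⟩, rfl⟩, h0⟩

/-- The coproduct on `H₀` induced by `∇`. -/
def H0Cobar.comul (X : Type u) [TopologicalSpace X] (b : X) :
    H0Cobar X b →ₐ[ℚ] H0Cobar X b ⊗[ℚ] H0Cobar X b :=
  H0.lift (((cobarPiPi X b).comp (nabla X b)).comp (cycles₀ (cobarGr X b) (cobarD X b)).val) <| by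
    intro z c _ hc
    have := comp_cobarD_eq_zero ((cobarPiPi X b).comp (nabla X b))
      (fun n σ => by rw [AlgHom.comp_apply]; exact cobarPiPi_nabla_gen σ) (fun σ => by
        rw [AlgHom.comp_apply, AlgHom.comp_apply, AlgHom.comp_apply, cobarPiPi_nabla_cubeGen,
          cobarPiPi_nabla_cubeGen, cobarPiPi_nabla_cubeGen, edge_face,
          Algebra.TensorProduct.tmul_mul_tmul]) c
    rw [AlgHom.comp_apply, Subalgebra.coe_val, ← hc]
    exact this

/-- The counit on `H₀` induced by the augmentation. -/
def H0Cobar.counit (X : Type u) [TopologicalSpace X] (b : X) : H0Cobar X b →ₐ[ℚ] ℚ :=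
  H0.lift ((cobarAug X b).comp (cycles₀ (cobarGr X b) (cobarD X b)).val) <| by
    intro z c _ hc
    have := comp_cobarD_eq_zero (cobarAug X b) (fun n σ => cobarAug_gen σ)
      (fun σ => by simp [cubeGen]) c
    rw [AlgHom.comp_apply, Subalgebra.coe_val, ← hc]
    exact this

lemma H0Cobar.comul_edge (σ : PSimplex X b 1) :
    H0Cobar.comul X b (edge σ) = edge σ ⊗ₜ[ℚ] edge σ :=
  cobarPiPi_nabla_cubeGen σ

lemma H0Cobar.counit_edge (σ : PSimplex X b 1) : H0Cobar.counit X b (edge σ) = 1 := by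
  have : cobarAug X b (cubeGen σ) = 1 := by simp [cubeGen]
  exact this

/-- The bialgebra structure on `H₀(Ω C_*(X, b; ℚ))` induced by the coproduct `∇` and the
augmentation of the cobar construction. -/
instance (X : Type u) [TopologicalSpace X] (b : X) : Bialgebra ℚ (H0Cobar X b) :=
  Bialgebra.ofAlgHom (H0Cobar.comul X b) (H0Cobar.counit X b)
    (H0Cobar.hom_ext fun σ => by simp [H0Cobar.comul_edge])
    (H0Cobar.hom_ext fun σ => by simp [H0Cobar.comul_edge, H0Cobar.counit_edge])
    (H0Cobar.hom_ext fun σ => by simp [H0Cobar.comul_edge, H0Cobar.counit_edge])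

end Coproduct

section Functoriality

variable {X Y Z : Type u} [TopologicalSpace X] [TopologicalSpace Y] [TopologicalSpace Z]
  {b : X} {c : Y} {e : Z}

/-- Composition of a pointed simplex with a pointed map. -/
def PSimplex.map (f : C(X, Y)) (hf : f b = c) {n : ℕ} (σ : PSimplex X b n) : PSimplex Y c n :=
  ⟨f.comp σ.1, fun i => by rw [ContinuousMap.comp_apply, σ.2 i, hf]⟩

lemma PSimplex.map_pull (f : C(X, Y)) (hf : f b = c) {m n : ℕ} (g : Fin (m + 1) → Fin (n + 1))
    (σ : PSimplex X b n) : (σ.pull g).map f hf = (σ.map f hf).pull g := rfl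

lemma PSimplex.IsDegenerate.map (f : C(X, Y)) (hf : f b = c) {n : ℕ} {σ : PSimplex X b n}
    (h : σ.IsDegenerate) : (σ.map f hf).IsDegenerate := by
  rcases n with _ | n
  · exact h.elim
  · obtain ⟨j, τ, rfl⟩ := h
    exact ⟨j, τ.map f hf, rfl⟩

/-- The map induced on pointed normalized chains. -/
def NChain.map (f : C(X, Y)) (hf : f b = c) (n : ℕ) : NChain X b n →ₗ[ℚ] NChain Y c n :=
  NChain.lift (fun σ => NChain.of (σ.map f hf)) fun _ h => NChain.of_eq_zero (h.map f hf)

/-- The map induced on cobar constructions. -/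
def cobarMap (f : C(X, Y)) (hf : f b = c) : Cobar X b →ₐ[ℚ] Cobar Y c :=
  TA.lift fun n => TA.gen (M := fun n => NChain Y c (n + 1)) n ∘ₗ NChain.map f hf (n + 1)

@[simp] lemma cobarMap_gen (f : C(X, Y)) (hf : f b = c) {n : ℕ} (σ : PSimplex X b (n + 1)) :
    cobarMap f hf (cobarGen σ) = cobarGen (σ.map f hf) := by
  simp [cobarMap, cobarGen, NChain.map]

@[simp] lemma cobarMap_cubeGen (f : C(X, Y)) (hf : f b = c) {n : ℕ} (σ : PSimplex X b n) :
    cobarMap f hf (cubeGen σ) = cubeGen (σ.map f hf) := by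
  rcases n with _ | _ | n <;> simp [cubeGen]

lemma cobarMap_mem (f : C(X, Y)) (hf : f b = c) {n : ℕ} {x : Cobar X b}
    (hx : x ∈ cobarGr X b n) : cobarMap f hf x ∈ cobarGr Y c n := by
  induction hx using Submodule.span_induction with
  | zero => simp
  | add x y hx hy ihx ihy => rw [map_add]; exact add_mem ihx ihy
  | smul r x hx ih => rw [map_smul]; exact Submodule.smul_mem _ _ ih
  | mem x hx =>
    obtain ⟨l, rfl, rfl⟩ := hx
    induction l with
    | nil => simpa using SetLike.one_mem_graded (cobarGr Y c)
    | cons p l ih =>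
      simp only [List.map_cons, List.prod_cons, List.sum_cons, map_mul]
      refine SetLike.mul_mem_graded ?_ ih
      rw [cobarMap, TA.lift_gen]
      exact TA.gen_mem _

lemma cobarMap_parity (f : C(X, Y)) (hf : f b = c) (x : Cobar X b) :
    cobarMap f hf (TA.parity x) = TA.parity (cobarMap f hf x) := by
  have : (cobarMap f hf).comp TA.parity = TA.parity.comp (cobarMap f hf) := by
    refine TA.hom_ext fun n x => ?_
    simp [TA.parity, cobarMap]
  exact AlgHom.congr_fun this x

lemma cobarMap_isDGHom (f : C(X, Y)) (hf : f b = c) :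
    IsDGHom (cobarGr X b) (cobarD X b) (cobarGr Y c) (cobarD Y c) (cobarMap f hf) where
  map_mem := cobarMap_mem f hf
  map_d x := by
    induction x using TA.induction_gen with
    | halg r => simp [cobarD]
    | hmul x y hx hy =>
      rw [cobarD, TA.deriv_mul, ← cobarD, map_add, map_mul, map_mul, hx, hy, map_mul, cobarD,
        TA.deriv_mul, cobarMap_parity]
    | hadd x y hx hy => rw [map_add, map_add, map_add, map_add, hx, hy]
    | hgen n x =>
      have : (cobarMap f hf).toLinearMap ∘ₗ cobarD X b ∘ₗ
          TA.gen (M := fun n => NChain X b (n + 1)) n =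
          cobarD Y c ∘ₗ (cobarMap f hf).toLinearMap ∘ₗ
            TA.gen (M := fun n => NChain X b (n + 1)) n := by
        refine NChain.hom_ext fun σ => ?_
        change cobarMap f hf (cobarD X b (cobarGen σ)) = cobarD Y c (cobarMap f hf (cobarGen σ))
        rw [cobarMap_gen]
        rcases n with _ | n
        · rw [cobarD_gen_zero, cobarD_gen_zero, map_zero]
        · rw [cobarD_gen_succ, cobarD_gen_succ]
          simp only [map_add, map_neg, map_sum, map_smul, map_mul, cobarMap_gen]
          rfl
      exact LinearMap.congr_fun this x

lemma H0map_edge (f : C(X, Y)) (hf : f b = c) (σ : PSimplex X b 1) :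
    (cobarMap_isDGHom f hf).H0map (edge σ) = edge (σ.map f hf) := by
  change H0.mk _ _ _ = H0.mk _ _ _
  congr 1
  exact Subtype.ext (cobarMap_cubeGen f hf σ)

/-- The bialgebra map `H₀(Ω C_*(X, b; ℚ)) → H₀(Ω C_*(Y, c; ℚ))` induced by a pointed map. -/
def H0Cobar.map (f : C(X, Y)) (hf : f b = c) : H0Cobar X b →ₐc[ℚ] H0Cobar Y c :=
  BialgHom.ofAlgHom (cobarMap_isDGHom f hf).H0map
    (H0Cobar.hom_ext fun σ => by
      rw [AlgHom.comp_apply, H0map_edge]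
      exact (H0Cobar.counit_edge _).trans (H0Cobar.counit_edge _).symm)
    (H0Cobar.hom_ext fun σ => by
      rw [AlgHom.comp_apply, AlgHom.comp_apply, H0map_edge]
      have h₁ : Bialgebra.comulAlgHom ℚ (H0Cobar X b) (edge σ) = _ := H0Cobar.comul_edge σ
      have h₂ : Bialgebra.comulAlgHom ℚ (H0Cobar Y c) (edge (σ.map f hf)) = _ :=
        H0Cobar.comul_edge (σ.map f hf)
      rw [h₁, h₂, Algebra.TensorProduct.map_tmul, H0map_edge])

end Functoriality

section Cubical

variable (M : Type u) [TopologicalSpace M]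

/-- Singular cubes `[0, 1]^n → M` of all dimensions. -/
structure Cube where
  /-- The dimension. -/
  dim : ℕ
  /-- The underlying map. -/
  toMap : C(Fin dim → unitInterval, M)

variable {M}

namespace Cube

/-- Evaluation of a cube on the first coordinates of a sequence. -/
def ev (a : Cube M) (y : ℕ → unitInterval) : M := a.toMap fun k => y k

/-- Extension of a point of a cube by zeros. -/
def ext₀ {n : ℕ} (x : Fin n → unitInterval) (k : ℕ) : unitInterval :=
  if h : k < n then x ⟨k, h⟩ else 0

lemma ext₀_val {n : ℕ} (x : Fin n → unitInterval) (k : Fin n) : ext₀ x k = x k := by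
  simp [ext₀]

lemma continuous_ext₀ {n : ℕ} (k : ℕ) :
    Continuous fun x : Fin n → unitInterval => ext₀ x k := by
  unfold ext₀
  split_ifs <;> fun_prop

lemma ext_ev {a c : Cube M} (h : a.dim = c.dim) (h' : ∀ y, a.ev y = c.ev y) : a = c := by
  obtain ⟨n, f⟩ := a
  obtain ⟨m, g⟩ := c
  obtain rfl : n = m := h
  congr 1
  ext x
  have := h' (ext₀ x)
  simpa [ev, ext₀_val] using this

lemma ev_congr (a : Cube M) {y y' : ℕ → unitInterval} (h : ∀ k < a.dim, y k = y' k) :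
    a.ev y = a.ev y' := by
  unfold ev
  congr 1
  funext k
  exact h k k.2

/-- Insertion of `ε` as the `i`-th coordinate. -/
def ins (i : ℕ) (ε : unitInterval) (y : ℕ → unitInterval) (k : ℕ) : unitInterval :=
  if k < i then y k else if k = i then ε else y (k - 1)

/-- The face of a cube on which the `i`-th coordinate is `ε` (for `i < dim`, counting from `0`). -/
def face (i : ℕ) (ε : unitInterval) (a : Cube M) : Cube M where
  dim := a.dim - 1
  toMap := a.toMap.comp ⟨fun x k => ins i ε (ext₀ x) k, by
    refine continuous_pi fun k => ?_
    unfold ins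
    split_ifs
    · exact continuous_ext₀ _
    · exact continuous_const
    · exact continuous_ext₀ _⟩

@[simp] lemma face_dim (i : ℕ) (ε : unitInterval) (a : Cube M) : (a.face i ε).dim = a.dim - 1 :=
  rfl

lemma face_ev {i : ℕ} (ε : unitInterval) (a : Cube M) (hi : i < a.dim) (y : ℕ → unitInterval) :
    (a.face i ε).ev y = a.ev (ins i ε y) := by
  change a.ev (ins i ε (ext₀ fun k : Fin (a.dim - 1) => y k)) = _
  refine ev_congr a fun k hk => ?_
  simp only [ins, ext₀]
  split_ifs <;> first | rfl | omega

lemma face_face {i j : ℕ} (ε η : unitInterval) (a : Cube M) (hij : i ≤ j) (hj : j + 1 < a.dim) :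
    (a.face i ε).face j η = (a.face (j + 1) η).face i ε := by
  refine ext_ev rfl fun y => ?_
  rw [face_ev _ _ (by simp; omega), face_ev _ _ (by omega), face_ev _ _ (by simp; omega),
    face_ev _ _ (by omega)]
  congr 1
  funext k
  simp only [ins]
  split_ifs <;> first | rfl | omega

/-- A cube is degenerate if it does not depend on one of its coordinates. -/
def IsDegenerate (a : Cube M) : Prop :=
  ∃ i : Fin a.dim, ∀ x x', (∀ k, k ≠ i → x k = x' k) → a.toMap x = a.toMap x'

lemma isDegenerate_iff (a : Cube M) : a.IsDegenerate ↔
    ∃ i < a.dim, ∀ y y', (∀ k, k ≠ i → y k = y' k) → a.ev y = a.ev y' := by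
  constructor
  · rintro ⟨i, h⟩
    exact ⟨i, i.2, fun y y' hy => h _ _ fun k hk => hy k fun h' => hk (Fin.ext h')⟩
  · rintro ⟨i, hi, h⟩
    refine ⟨⟨i, hi⟩, fun x x' hx => ?_⟩
    have := h (ext₀ x) (ext₀ x') fun k hk => by
      unfold ext₀
      split_ifs with h'
      · exact hx _ fun h'' => hk (congrArg Fin.val h'')
      · rfl
    simpa [ev, ext₀_val] using this

variable [Monoid M] [ContinuousMul M]

instance : Monoid (Cube M) where
  mul a c := ⟨a.dim + c.dim,
    ⟨fun x => a.toMap (fun k => x (Fin.castAdd c.dim k)) * c.toMap (fun k => x (Fin.natAdd a.dim k)),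
      by fun_prop⟩⟩
  one := ⟨0, ContinuousMap.const _ 1⟩
  mul_assoc a c e := ext_ev (add_assoc _ _ _) fun y => by
    refine (mul_assoc (a.ev y) (c.ev fun k => y (a.dim + k))
      (e.ev fun k => y (a.dim + c.dim + k))).trans ?_
    simp only [add_assoc]
    rfl
  one_mul a := ext_ev (zero_add _) fun y => by
    refine (one_mul (a.ev fun k => y (0 + k))).trans ?_
    simp only [zero_add]
  mul_one a := ext_ev (add_zero _) fun y => mul_one (a.ev y)

lemma mul_dim (a c : Cube M) : (a * c).dim = a.dim + c.dim := rfl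

lemma one_dim : (1 : Cube M).dim = 0 := rfl

lemma mul_ev (a c : Cube M) (y : ℕ → unitInterval) :
    (a * c).ev y = a.ev y * c.ev fun k => y (a.dim + k) := rfl

lemma face_mul_left {i : ℕ} (ε : unitInterval) (a c : Cube M) (hi : i < a.dim) :
    (a * c).face i ε = a.face i ε * c := by
  refine ext_ev (by simp only [face_dim, mul_dim]; omega) fun y => ?_
  rw [face_ev _ _ (by rw [mul_dim]; omega), mul_ev, mul_ev, face_ev _ _ hi]
  congr 2
  funext k
  simp only [ins, face_dim]
  rw [if_neg (by omega), if_neg (by omega)]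
  congr 1
  omega

lemma face_mul_right {i : ℕ} (ε : unitInterval) (a c : Cube M) (hi : i < c.dim) :
    (a * c).face (a.dim + i) ε = a * c.face i ε := by
  refine ext_ev (by simp only [face_dim, mul_dim]; omega) fun y => ?_
  rw [face_ev _ _ (by rw [mul_dim]; omega), mul_ev, mul_ev, face_ev _ _ hi]
  congr 1
  · refine ev_congr a fun k hk => ?_
    simp only [ins]
    rw [if_pos (by omega)]
  · congr 1
    funext k
    simp only [ins]
    split_ifs <;> first | rfl | omega | (congr 1; omega)

lemma IsDegenerate.mul_left {a : Cube M} (h : a.IsDegenerate) (c : Cube M) :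
    (c * a).IsDegenerate := by
  rw [isDegenerate_iff] at h ⊢
  obtain ⟨i, hi, h⟩ := h
  refine ⟨c.dim + i, by rw [mul_dim]; omega, fun y y' hy => ?_⟩
  rw [mul_ev, mul_ev]
  congr 1
  · exact ev_congr c fun k hk => hy k (by omega)
  · exact h _ _ fun k hk => hy _ (by omega)

lemma IsDegenerate.mul_right {a : Cube M} (h : a.IsDegenerate) (c : Cube M) :
    (a * c).IsDegenerate := by
  rw [isDegenerate_iff] at h ⊢
  obtain ⟨i, hi, h⟩ := h
  refine ⟨i, by rw [mul_dim]; omega, fun y y' hy => ?_⟩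
  rw [mul_ev, mul_ev, h y y' hy]
  congr 2
  funext k
  exact hy _ (by omega)

end Cube

variable (M) [Monoid M] [ContinuousMul M]

lemma single_eq_smul {G : Type*} (g : G) (q : ℚ) : (MonoidAlgebra.single g q : MonoidAlgebra ℚ G) =
    q • MonoidAlgebra.single g 1 := by
  rw [MonoidAlgebra.smul_single, smul_eq_mul, mul_one]

/-- The two-sided ideal of degenerate cubical chains: the span of the degenerate cubes. -/
def degenerateCubes : Ideal (MonoidAlgebra ℚ (Cube M)) where
  carrier := Submodule.span ℚ
    ((fun a : Cube M => MonoidAlgebra.single a (1 : ℚ)) '' {a | a.IsDegenerate})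
  add_mem' := add_mem
  zero_mem' := zero_mem _
  smul_mem' r x hx := by
    simp only [SetLike.mem_coe, smul_eq_mul] at hx ⊢
    induction hx using Submodule.span_induction with
    | zero => simp
    | add x y hx hy ihx ihy => rw [mul_add]; exact add_mem ihx ihy
    | smul s x hx ih => rw [mul_smul_comm]; exact Submodule.smul_mem _ _ ih
    | mem x hx =>
      obtain ⟨a, ha, rfl⟩ := hx
      induction r using MonoidAlgebra.induction_linear with
      | zero => simp
      | add r s hr hs => rw [add_mul]; exact add_mem hr hs
      | single c q =>
        rw [MonoidAlgebra.single_mul_single, mul_one, single_eq_smul]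
        exact Submodule.smul_mem _ _ (Submodule.subset_span ⟨_, ha.mul_left c, rfl⟩)

lemma mem_degenerateCubes {x : MonoidAlgebra ℚ (Cube M)} : x ∈ degenerateCubes M ↔
    x ∈ Submodule.span ℚ
      ((fun a : Cube M => MonoidAlgebra.single a (1 : ℚ)) '' {a | a.IsDegenerate}) := Iff.rfl

instance : (degenerateCubes M).IsTwoSided where
  mul_mem_of_left {x} r hx := by
    rw [mem_degenerateCubes] at hx ⊢
    induction hx using Submodule.span_induction with
    | zero => simp
    | add x y hx hy ihx ihy => rw [add_mul]; exact add_mem ihx ihy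
    | smul s x hx ih => rw [smul_mul_assoc]; exact Submodule.smul_mem _ _ ih
    | mem x hx =>
      obtain ⟨a, ha, rfl⟩ := hx
      induction r using MonoidAlgebra.induction_linear with
      | zero => simp
      | add r s hr hs => rw [mul_add]; exact add_mem hr hs
      | single c q =>
        rw [MonoidAlgebra.single_mul_single, one_mul, single_eq_smul]
        exact Submodule.smul_mem _ _ (Submodule.subset_span ⟨_, ha.mul_right c, rfl⟩)

/-- The algebra `C^□_*(M; ℚ)` of normalized singular cubical chains on a topological monoid. -/
def CubeChains : Type u := MonoidAlgebra ℚ (Cube M) ⧸ degenerateCubes M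

instance : Ring (CubeChains M) :=
  inferInstanceAs (Ring (MonoidAlgebra ℚ (Cube M) ⧸ degenerateCubes M))
instance : Algebra ℚ (CubeChains M) :=
  inferInstanceAs (Algebra ℚ (MonoidAlgebra ℚ (Cube M) ⧸ degenerateCubes M))

/-- The projection from cubical chains to normalized ones. -/
def CubeChains.proj : MonoidAlgebra ℚ (Cube M) →ₐ[ℚ] CubeChains M :=
  Ideal.Quotient.mkₐ ℚ (degenerateCubes M)

lemma CubeChains.proj_surjective : Function.Surjective (CubeChains.proj M) :=
  Ideal.Quotient.mkₐ_surjective ℚ (degenerateCubes M)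

variable {M}

/-- The class of a cube. -/
def CubeChains.of (a : Cube M) : CubeChains M := CubeChains.proj M (MonoidAlgebra.single a 1)

lemma CubeChains.of_eq_zero {a : Cube M} (h : a.IsDegenerate) : CubeChains.of a = 0 :=
  Ideal.Quotient.eq_zero_iff_mem.2 ((mem_degenerateCubes M).2 (Submodule.subset_span ⟨a, h, rfl⟩))

lemma CubeChains.of_mul (a c : Cube M) :
    CubeChains.of (a * c) = CubeChains.of a * CubeChains.of c := by
  rw [CubeChains.of, CubeChains.of, CubeChains.of, ← map_mul, MonoidAlgebra.single_mul_single,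
    mul_one]

lemma CubeChains.of_one : CubeChains.of (1 : Cube M) = 1 := by
  rw [CubeChains.of, ← MonoidAlgebra.one_def, map_one]

lemma CubeChains.induction {C : CubeChains M → Prop} (h0 : C 0)
    (hadd : ∀ x y, C x → C y → C (x + y)) (hsmul : ∀ (r : ℚ) x, C x → C (r • x))
    (hof : ∀ a, C (CubeChains.of a)) (x : CubeChains M) : C x := by
  obtain ⟨x, rfl⟩ := CubeChains.proj_surjective M x
  induction x using MonoidAlgebra.induction_linear with
  | zero => simpa using h0
  | add r s hr hs => rw [map_add]; exact hadd _ _ hr hs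
  | single c q =>
    rw [single_eq_smul, map_smul]
    exact hsmul _ _ (hof c)

/-- Linear extension of a function on cubes which vanishes on degenerate ones. -/
def CubeChains.lift {W : Type*} [AddCommGroup W] [Module ℚ W] (f : Cube M → W)
    (hf : ∀ a, a.IsDegenerate → f a = 0) : CubeChains M →ₗ[ℚ] W :=
  ((degenerateCubes M).restrictScalars ℚ).liftQ
    (Finsupp.linearCombination ℚ f ∘ₗ (MonoidAlgebra.coeffLinearEquiv ℚ).toLinearMap) (by
      have h : (degenerateCubes M).restrictScalars ℚ = Submodule.span ℚ
        ((fun a : Cube M => MonoidAlgebra.single a (1 : ℚ)) '' {a | a.IsDegenerate}) := rfl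
      rw [h, Submodule.span_le]
      rintro _ ⟨a, ha, rfl⟩
      simpa using hf a ha) ∘ₗ
    (Submodule.Quotient.restrictScalarsEquiv ℚ (degenerateCubes M)).symm.toLinearMap

@[simp] lemma CubeChains.lift_of {W : Type*} [AddCommGroup W] [Module ℚ W] (f : Cube M → W)
    (hf : ∀ a, a.IsDegenerate → f a = 0) (a : Cube M) :
    CubeChains.lift f hf (CubeChains.of a) = f a := by
  have : CubeChains.lift f hf (CubeChains.of a) = Finsupp.linearCombination ℚ f
    ((MonoidAlgebra.coeffLinearEquiv ℚ) (MonoidAlgebra.single a (1 : ℚ))) := rfl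
  rw [this]
  simp

/-- The chains of degree `n`: the span of the `n`-cubes. -/
def cubeGr (M : Type u) [TopologicalSpace M] [Monoid M] [ContinuousMul M] (n : ℕ) :
    Submodule ℚ (CubeChains M) :=
  Submodule.span ℚ (CubeChains.of '' {a | a.dim = n})

lemma CubeChains.of_mem (a : Cube M) : CubeChains.of a ∈ cubeGr M a.dim :=
  Submodule.subset_span ⟨a, rfl, rfl⟩

instance : SetLike.GradedMonoid (cubeGr M) where
  one_mem := Submodule.subset_span ⟨1, rfl, CubeChains.of_one⟩
  mul_mem := by
    intro i j x y hx hy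
    have : x * y ∈ cubeGr M i * cubeGr M j := Submodule.mul_mem_mul hx hy
    rw [cubeGr, cubeGr, Submodule.span_mul_span] at this
    refine Submodule.span_mono ?_ this
    rintro _ ⟨_, ⟨a, rfl, rfl⟩, _, ⟨c, rfl, rfl⟩, rfl⟩
    exact ⟨a * c, rfl, CubeChains.of_mul a c⟩

/-- Auxiliary: the decomposition into homogeneous components, on unnormalized chains. -/
def cubeDecomp₀ : MonoidAlgebra ℚ (Cube M) →ₐ[ℚ] ⨁ n, cubeGr M n :=
  MonoidAlgebra.lift ℚ _ (Cube M)
    { toFun := fun a => DirectSum.of (fun n => cubeGr M n) a.dim ⟨CubeChains.of a, CubeChains.of_mem a⟩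
      map_one' := DirectSum.of_eq_of_gradedMonoid_eq
        (Sigma.subtype_ext rfl CubeChains.of_one)
      map_mul' := fun a c => by
        rw [DirectSum.of_mul_of]
        exact DirectSum.of_eq_of_gradedMonoid_eq (Sigma.subtype_ext rfl (CubeChains.of_mul a c)) }

/-- Auxiliary: the decomposition into homogeneous components. -/
def cubeDecomp : CubeChains M →ₐ[ℚ] ⨁ n, cubeGr M n :=
  Ideal.Quotient.liftₐ (degenerateCubes M) cubeDecomp₀ fun x hx => by
    rw [mem_degenerateCubes] at hx
    induction hx using Submodule.span_induction with
    | zero => simp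
    | add x y hx hy ihx ihy => rw [map_add, ihx, ihy, add_zero]
    | smul s x hx ih => rw [map_smul, ih, smul_zero]
    | mem x hx =>
      obtain ⟨a, ha, rfl⟩ := hx
      simp only [cubeDecomp₀, MonoidAlgebra.lift_single, one_smul]
      change DirectSum.of (fun n => cubeGr M n) a.dim ⟨CubeChains.of a, _⟩ = 0
      simp only [CubeChains.of_eq_zero ha]
      exact map_zero (DirectSum.of (fun n => cubeGr M n) a.dim)

lemma cubeDecomp_of (a : Cube M) : cubeDecomp (CubeChains.of a) =
    DirectSum.of (fun n => cubeGr M n) a.dim ⟨CubeChains.of a, CubeChains.of_mem a⟩ := by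
  have : cubeDecomp (CubeChains.of a) = cubeDecomp₀ (MonoidAlgebra.single a 1) := rfl
  rw [this, cubeDecomp₀, MonoidAlgebra.lift_single, one_smul]
  rfl

instance : GradedAlgebra (cubeGr M) :=
  GradedAlgebra.ofAlgHom (cubeGr M) cubeDecomp
    (by
      ext x
      induction x using CubeChains.induction with
      | h0 => simp
      | hadd x y hx hy => rw [map_add, map_add, hx, hy]
      | hsmul r x hx => rw [map_smul, map_smul, hx]
      | hof a =>
        rw [AlgHom.comp_apply, cubeDecomp_of, DirectSum.coeAlgHom_of]
        rfl)
    (by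
      rintro i ⟨x, hx⟩
      induction hx using Submodule.span_induction with
      | zero => simp only [map_zero]; exact (map_zero (DirectSum.of (fun i => cubeGr M i) i)).symm
      | add x y hx hy ihx ihy =>
        simp only [map_add, ihx, ihy]
        exact (map_add (DirectSum.of (fun i => cubeGr M i) i) _ _).symm
      | smul r x hx ih =>
        simp only [map_smul, ih]
        exact (map_smul (DirectSum.lof ℚ ℕ (fun i => cubeGr M i) i) _ _).symm
      | mem x hx =>
        obtain ⟨a, rfl, rfl⟩ := hx
        exact cubeDecomp_of a)

/-- The boundary `∑ (-1)^i (∂ᵢ¹ - ∂ᵢ⁰)` of a cube. -/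
def cubeBd (a : Cube M) : CubeChains M :=
  ∑ i ∈ Finset.range a.dim, (-1 : ℚ) ^ i •
    (CubeChains.of (a.face i 1) - CubeChains.of (a.face i 0))

lemma cubeBd_eq_zero {a : Cube M} (h : a.IsDegenerate) : cubeBd a = 0 := by
  rw [Cube.isDegenerate_iff] at h
  obtain ⟨i, hi, h⟩ := h
  refine Finset.sum_eq_zero fun j hj => ?_
  rw [Finset.mem_range] at hj
  rcases lt_trichotomy i j with hij | rfl | hij
  · have : ∀ ε, CubeChains.of (a.face j ε) = 0 := fun ε =>
      CubeChains.of_eq_zero <| (Cube.isDegenerate_iff _).2 ⟨i, by rw [Cube.face_dim]; omega, by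
        intro y y' hy
        rw [Cube.face_ev _ _ hj, Cube.face_ev _ _ hj]
        refine h _ _ fun k hk => ?_
        simp only [Cube.ins]
        split_ifs <;> first | rfl | exact hy _ (by omega)⟩
    rw [this, this, sub_zero, smul_zero]
  · have : a.face i 1 = a.face i 0 := Cube.ext_ev rfl fun y => by
      rw [Cube.face_ev _ _ hj, Cube.face_ev _ _ hj]
      refine h _ _ fun k hk => ?_
      simp only [Cube.ins, if_neg hk]
    rw [this, sub_self, smul_zero]
  · have : ∀ ε, CubeChains.of (a.face j ε) = 0 := fun ε =>
      CubeChains.of_eq_zero <| (Cube.isDegenerate_iff _).2 ⟨i - 1, by rw [Cube.face_dim]; omega, by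
        intro y y' hy
        rw [Cube.face_ev _ _ hj, Cube.face_ev _ _ hj]
        refine h _ _ fun k hk => ?_
        simp only [Cube.ins]
        split_ifs <;> first | rfl | exact hy _ (by omega)⟩
    rw [this, this, sub_zero, smul_zero]

/-- The differential of the normalized cubical chains. -/
def cubeD (M : Type u) [TopologicalSpace M] [Monoid M] [ContinuousMul M] :
    CubeChains M →ₗ[ℚ] CubeChains M :=
  CubeChains.lift cubeBd fun _ h => cubeBd_eq_zero h

lemma cubeD_of (a : Cube M) : cubeD M (CubeChains.of a) = cubeBd a := CubeChains.lift_of _ _ a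

lemma cubeBd_mul (a c : Cube M) : cubeBd (a * c) =
    cubeBd a * CubeChains.of c + (-1 : ℚ) ^ a.dim • (CubeChains.of a * cubeBd c) := by
  rw [cubeBd, Cube.mul_dim, Finset.sum_range_add]
  congr 1
  · rw [cubeBd, Finset.sum_mul]
    refine Finset.sum_congr rfl fun i hi => ?_
    rw [Finset.mem_range] at hi
    rw [Cube.face_mul_left _ _ _ hi, Cube.face_mul_left _ _ _ hi, CubeChains.of_mul,
      CubeChains.of_mul, smul_mul_assoc, sub_mul]
  · rw [cubeBd, Finset.mul_sum, Finset.smul_sum]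
    refine Finset.sum_congr rfl fun i hi => ?_
    rw [Finset.mem_range] at hi
    rw [Cube.face_mul_right _ _ _ hi, Cube.face_mul_right _ _ _ hi, CubeChains.of_mul,
      CubeChains.of_mul, mul_smul_comm, mul_sub, pow_add, mul_smul]

lemma cubeD_cubeBd (a : Cube M) : cubeD M (cubeBd a) = 0 := by
  rcases hn : a.dim with _ | P
  · simp [cubeBd, hn]
  rw [← sum_sum_alternating P (fun i j =>
    CubeChains.of ((a.face i 1).face j 1) - CubeChains.of ((a.face i 1).face j 0) -
      (CubeChains.of ((a.face i 0).face j 1) - CubeChains.of ((a.face i 0).face j 0)))]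
  · rw [cubeBd, hn, map_sum]
    refine Finset.sum_congr rfl fun i _ => ?_
    rw [map_smul, map_sub, cubeD_of, cubeD_of, cubeBd, cubeBd, Cube.face_dim, Cube.face_dim, hn,
      Nat.add_sub_cancel, ← Finset.sum_sub_distrib, Finset.smul_sum]
    refine Finset.sum_congr rfl fun j _ => ?_
    rw [pow_add, mul_smul, ← smul_sub]
  · intro i j hij hj
    rw [Cube.face_face _ _ _ hij (by omega), Cube.face_face _ _ _ hij (by omega),
      Cube.face_face _ _ _ hij (by omega), Cube.face_face _ _ _ hij (by omega)]
    abel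

/-- The normalized cubical chains on a topological monoid are a differential graded algebra. -/
instance : IsDGAlgebra (cubeGr M) (cubeD M) where
  d_mem {n x} h := by
    induction h using Submodule.span_induction with
    | zero => simp
    | add x y hx hy ihx ihy => rw [map_add]; exact add_mem ihx ihy
    | smul r x hx ih => rw [map_smul]; exact Submodule.smul_mem _ _ ih
    | mem x hx =>
      obtain ⟨a, ha, rfl⟩ := hx
      rw [cubeD_of]
      have : ∀ i ε, CubeChains.of (a.face i ε) ∈ cubeGr M n := fun i ε =>
        Submodule.subset_span ⟨_, by
          rw [Set.mem_ofPred_eq] at ha ⊢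
          rw [Cube.face_dim, ha, Nat.add_sub_cancel], rfl⟩
      exact sum_mem fun i _ => Submodule.smul_mem _ _ (sub_mem (this _ _) (this _ _))
  d_zero {x} h := by
    induction h using Submodule.span_induction with
    | zero => simp
    | add x y hx hy ihx ihy => rw [map_add, ihx, ihy, add_zero]
    | smul r x hx ih => rw [map_smul, ih, smul_zero]
    | mem x hx =>
      obtain ⟨a, ha, rfl⟩ := hx
      rw [Set.mem_ofPred_eq] at ha
      rw [cubeD_of, cubeBd, ha, Finset.sum_range_zero]
  leibniz {n x} y h := by
    induction h using Submodule.span_induction with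
    | zero => simp
    | add x x' hx hx' ihx ihx' => 
      rw [add_mul, map_add, ihx, ihx', map_add, add_mul, add_mul, smul_add]
      abel
    | smul r x hx ih =>
      rw [smul_mul_assoc, map_smul, ih, map_smul, smul_mul_assoc, smul_mul_assoc, smul_add,
        smul_comm r]
    | mem x hx =>
      obtain ⟨a, rfl, rfl⟩ := hx
      induction y using CubeChains.induction with
      | h0 => simp
      | hadd y y' hy hy' =>
        rw [mul_add, map_add, hy, hy', map_add, mul_add, mul_add, smul_add]
        abel
      | hsmul r y hy =>
        rw [mul_smul_comm, map_smul, hy, map_smul, mul_smul_comm, mul_smul_comm, smul_add,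
          smul_comm r]
      | hof c => rw [← CubeChains.of_mul, cubeD_of, cubeD_of, cubeD_of, cubeBd_mul]
  d_d x := by
    induction x using CubeChains.induction with
    | h0 => simp
    | hadd x y hx hy => rw [map_add, map_add, hx, hy, add_zero]
    | hsmul r x hx => rw [map_smul, map_smul, hx, smul_zero]
    | hof a => rw [cubeD_of, cubeD_cubeBd]

/-- The `0`-cube given by a point. -/
def Cube.point (x : M) : Cube M := ⟨0, ContinuousMap.const _ x⟩

/-- The class in `H₀` of a point. -/
def pointClass (x : M) : H0 (cubeGr M) (cubeD M) :=
  H0.mk (cubeGr M) (cubeD M)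
    (cycle (cubeGr M) (cubeD M) (CubeChains.of (Cube.point x)) (CubeChains.of_mem (Cube.point x)))

lemma pointClass_one : pointClass (1 : M) = 1 := by
  rw [pointClass, ← map_one (H0.mk (cubeGr M) (cubeD M))]
  exact congrArg _ (Subtype.ext CubeChains.of_one)

lemma pointClass_mul (x y : M) : pointClass (x * y) = pointClass x * pointClass y := by
  rw [pointClass, pointClass, pointClass, ← map_mul]
  congr 1
  refine Subtype.ext ?_
  change CubeChains.of _ = CubeChains.of _ * CubeChains.of _
  rw [← CubeChains.of_mul]
  rfl

/-- The `1`-cube given by a path. -/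
def Cube.path (p : C(unitInterval, M)) : Cube M :=
  ⟨1, p.comp ⟨fun x => x 0, continuous_apply 0⟩⟩

lemma Cube.path_face (p : C(unitInterval, M)) (ε : unitInterval) :
    (Cube.path p).face 0 ε = Cube.point (p ε) :=
  Cube.ext_ev rfl fun y => by
    rw [Cube.face_ev _ _ (by exact one_pos)]
    change p (Cube.ins 0 ε y 0) = p ε
    simp [Cube.ins]

lemma pointClass_eq_of_path (p : C(unitInterval, M)) :
    pointClass (p 0) = pointClass (p 1) := by
  rw [eq_comm, ← sub_eq_zero, pointClass, pointClass, ← map_sub, H0.mk_eq_zero]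
  have hm : CubeChains.of (Cube.path p) ∈ cubeGr M 1 := CubeChains.of_mem (Cube.path p)
  refine ⟨CubeChains.of (Cube.path p), hm, ?_⟩
  have h : cubeBd (Cube.path p) = ∑ i ∈ Finset.range 1, (-1 : ℚ) ^ i •
    (CubeChains.of ((Cube.path p).face i 1) - CubeChains.of ((Cube.path p).face i 0)) := rfl
  rw [cubeD_of, h, Finset.sum_range_one, pow_zero, one_smul, Cube.path_face, Cube.path_face]
  rfl

end Cubical

section Moore

variable {X : Type u} [TopologicalSpace X] {b : X}

/-- The space `Ω_b X` of Moore loops: pairs of a map `γ : [0, ∞) → X` and a length `r ≥ 0` such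
that `γ 0 = b` and `γ t = b` for `t ≥ r`, with the topology of `C([0, ∞), X) × [0, ∞)`. -/
def MooreLoop (X : Type u) [TopologicalSpace X] (b : X) : Type u :=
  {p : C(ℝ≥0, X) × ℝ≥0 // p.1 0 = b ∧ ∀ t, p.2 ≤ t → p.1 t = b}

namespace MooreLoop

instance : TopologicalSpace (MooreLoop X b) :=
  inferInstanceAs (TopologicalSpace {p : C(ℝ≥0, X) × ℝ≥0 // p.1 0 = b ∧ ∀ t, p.2 ≤ t → p.1 t = b})

/-- The underlying map of a Moore loop. -/
def toMap (γ : MooreLoop X b) : C(ℝ≥0, X) := γ.1.1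

/-- The length of a Moore loop. -/
def length (γ : MooreLoop X b) : ℝ≥0 := γ.1.2

lemma toMap_zero (γ : MooreLoop X b) : γ.toMap 0 = b := γ.2.1

lemma toMap_of_length_le (γ : MooreLoop X b) {t : ℝ≥0} (h : γ.length ≤ t) : γ.toMap t = b :=
  γ.2.2 t h

lemma ext {γ δ : MooreLoop X b} (h₁ : ∀ t, γ.toMap t = δ.toMap t) (h₂ : γ.length = δ.length) :
    γ = δ :=
  Subtype.ext (Prod.ext (ContinuousMap.ext h₁) h₂)

lemma continuous_toMap : Continuous (toMap : MooreLoop X b → C(ℝ≥0, X)) :=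
  continuous_fst.comp continuous_subtype_val

lemma continuous_length : Continuous (length : MooreLoop X b → ℝ≥0) :=
  continuous_snd.comp continuous_subtype_val

/-- A family of Moore loops is continuous if its uncurried map and its lengths are. -/
lemma continuous_mk {T : Type*} [TopologicalSpace T] (f : T → MooreLoop X b)
    (h₁ : Continuous fun p : T × ℝ≥0 => (f p.1).toMap p.2)
    (h₂ : Continuous fun t => (f t).length) : Continuous f :=
  Continuous.subtype_mk
    ((ContinuousMap.continuous_of_continuous_uncurry (fun t => (f t).toMap) h₁).prodMk h₂) _

/-- The underlying function of the concatenation of Moore loops. -/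
def mulFun (γ δ : MooreLoop X b) (t : ℝ≥0) : X :=
  if t ≤ γ.length then γ.toMap t else δ.toMap (t - γ.length)

lemma continuous_mulFun {T : Type*} [TopologicalSpace T] {f g : T → MooreLoop X b} {s : T → ℝ≥0}
    (hf : Continuous f) (hg : Continuous g) (hs : Continuous s) :
    Continuous fun t => mulFun (f t) (g t) (s t) := by
  unfold mulFun
  have hf₁ := continuous_toMap.comp hf
  have hf₂ := continuous_length.comp hf
  have hg₁ := continuous_toMap.comp hg
  refine Continuous.if_le (hf₁.eval hs) (hg₁.eval (hs.sub hf₂)) hs hf₂ fun t ht => ?_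
  have ht' : s t = (f t).length := ht
  rw [ht', tsub_self, toMap_zero, toMap_of_length_le _ le_rfl]

/-- Concatenation of Moore loops: first `γ`, then `δ`; the lengths add up. -/
instance : Mul (MooreLoop X b) where
  mul γ δ := ⟨(⟨mulFun γ δ, continuous_mulFun continuous_const continuous_const continuous_id⟩,
    γ.length + δ.length), by
      constructor
      · simp only [ContinuousMap.coe_mk, mulFun, zero_le, if_true, toMap_zero]
      · intro t ht
        simp only [ContinuousMap.coe_mk, mulFun] at ht ⊢
        split_ifs with h
        · have : γ.length = t := le_antisymm (le_trans le_self_add ht) h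
          exact toMap_of_length_le _ this.le
        · exact toMap_of_length_le _ (le_tsub_of_add_le_left ht)⟩

lemma mul_toMap (γ δ : MooreLoop X b) (t : ℝ≥0) : (γ * δ).toMap t =
    if t ≤ γ.length then γ.toMap t else δ.toMap (t - γ.length) := rfl

lemma mul_length (γ δ : MooreLoop X b) : (γ * δ).length = γ.length + δ.length := rfl

/-- The loop of length `0`. -/
instance : One (MooreLoop X b) where
  one := ⟨(ContinuousMap.const _ b, 0), by simp⟩

lemma one_toMap (t : ℝ≥0) : (1 : MooreLoop X b).toMap t = b := rfl

lemma one_length : (1 : MooreLoop X b).length = 0 := rfl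

/-- The monoid of Moore loops. -/
instance : Monoid (MooreLoop X b) where
  mul_assoc γ δ ε := ext (fun t => by
    rw [mul_toMap, mul_toMap, mul_toMap, mul_toMap]
    by_cases h₁ : t ≤ γ.length
    · rw [if_pos h₁, if_pos h₁, if_pos (by rw [mul_length]; exact le_trans h₁ le_self_add)]
    · rw [if_neg h₁, if_neg h₁]
      have : t ≤ (γ * δ).length ↔ t - γ.length ≤ δ.length := by
        rw [mul_length, tsub_le_iff_left]
      by_cases h₂ : t - γ.length ≤ δ.length
      · rw [if_pos h₂, if_pos (this.2 h₂)]
      · rw [if_neg h₂, if_neg (mt this.1 h₂), mul_length, tsub_add_eq_tsub_tsub]) (add_assoc _ _ _)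
  one_mul γ := ext (fun t => by
    simp only [mul_toMap, one_length, one_toMap, tsub_zero]
    split_ifs with h
    · rw [le_antisymm h bot_le, toMap_zero]
    · rfl) (zero_add _)
  mul_one γ := ext (fun t => by
    simp only [mul_toMap, one_toMap]
    split_ifs with h
    · rfl
    · exact (toMap_of_length_le _ (not_le.1 h).le).symm) (add_zero _)

instance : ContinuousMul (MooreLoop X b) where
  continuous_mul := continuous_mk _
    (continuous_mulFun (continuous_fst.comp continuous_fst) (continuous_snd.comp continuous_fst)
      continuous_snd)
    ((continuous_length.comp continuous_fst).add (continuous_length.comp continuous_snd))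

/-- The path `t ↦ γ (r t)` on `[0, 1]` given by a Moore loop `γ` of length `r`. -/
def toPath (γ : MooreLoop X b) : Path b b where
  toFun t := γ.toMap (γ.length * Real.toNNReal t)
  continuous_toFun := by fun_prop
  source' := by simp [toMap_zero]
  target' := by simp [toMap_of_length_le]

end MooreLoop

/-- The fundamental group in which `p * q` is the class of the path `p` followed by `q`; the
multiplication of `FundamentalGroup X b` is in the opposite order. -/
abbrev Pi1 (X : Type u) [TopologicalSpace X] (b : X) : Type u := (FundamentalGroup X b)ᵐᵒᵖ

/-- The class of a loop in the fundamental group. -/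
def Pi1.mk (p : Path b b) : Pi1 X b :=
  MulOpposite.op (FundamentalGroup.fromPath (Path.Homotopic.Quotient.mk p))

lemma Pi1.mk_trans (p q : Path b b) : Pi1.mk (p.trans q) = Pi1.mk p * Pi1.mk q := rfl

/-- The homomorphism of fundamental groups induced by a pointed map. -/
def Pi1.map {Y : Type u} [TopologicalSpace Y] {c : Y} (f : C(X, Y)) (hf : f b = c) :
    Pi1 X b →* Pi1 Y c :=
  (FundamentalGroup.mapOfEq f hf).op

/-- The standard path from the vertex `0` to the vertex `1` of the `1`-simplex. -/
def edgePoint (t : ℝ≥0) : stdSimplex ℝ (Fin 2) :=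
  ⟨![1 - min (t : ℝ) 1, min (t : ℝ) 1], by
    constructor
    · intro i
      fin_cases i <;> simp
    · simp [Fin.sum_univ_two]⟩

lemma continuous_edgePoint : Continuous edgePoint := by
  refine Continuous.subtype_mk (continuous_pi fun i => ?_) _
  fin_cases i <;> simp <;> fun_prop

lemma edgePoint_zero : edgePoint 0 = stdSimplex.vertex 0 := by
  ext i
  fin_cases i <;> simp [edgePoint] <;> rfl

lemma edgePoint_of_le {t : ℝ≥0} (ht : 1 ≤ t) : edgePoint t = stdSimplex.vertex 1 := by
  have ht : (1 : ℝ) ≤ t := ht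
  ext i
  fin_cases i <;> simp [edgePoint, ht] <;> rfl

/-- The Moore loop of length `1` given by a pointed `1`-simplex. -/
def PSimplex.loop (σ : PSimplex X b 1) : MooreLoop X b :=
  ⟨(σ.1.comp ⟨edgePoint, continuous_edgePoint⟩, 1),
    (congrArg σ.1 edgePoint_zero).trans (σ.2 0),
    fun _ ht => (congrArg σ.1 (edgePoint_of_le ht)).trans (σ.2 1)⟩

/-- The path in the `2`-simplex which follows the edge from `0` to `1` on `[0, 1]` and, starting at
time `s`, moves towards the vertex `2`. For `s = 1` it runs through the vertex `1`, for `s = 0` it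
runs along the edge from `0` to `2`. -/
def trianglePoint (s : unitInterval) (t : ℝ≥0) : stdSimplex ℝ (Fin 3) :=
  ⟨![1 - min (t : ℝ) 1, min (t : ℝ) 1 - min (max (t - s : ℝ) 0) 1, min (max (t - s : ℝ) 0) 1], by
    constructor
    · intro i
      have h₁ : (t : ℝ) - s ≤ t := by linarith [s.2.1]
      have h₂ : max ((t : ℝ) - s) 0 ≤ t := max_le h₁ t.2
      have h₃ := min_le_min_right 1 h₂
      have h₄ : 0 ≤ min (max ((t : ℝ) - s) 0) 1 := le_min (le_max_right _ _) zero_le_one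
      fin_cases i
      · simp
      · exact sub_nonneg.2 h₃
      · exact h₄
    · simp [Fin.sum_univ_three]⟩

lemma continuous_trianglePoint :
    Continuous fun p : unitInterval × ℝ≥0 => trianglePoint p.1 p.2 := by
  refine Continuous.subtype_mk (continuous_pi fun i => ?_) _
  fin_cases i <;> simp <;> fun_prop

lemma trianglePoint_zero (s : unitInterval) : trianglePoint s 0 = stdSimplex.vertex 0 := by
  have : max (-(s : ℝ)) 0 = 0 := max_eq_right (by linarith [s.2.1])
  ext i
  fin_cases i <;> simp [trianglePoint, s.2.1] <;> rfl

lemma trianglePoint_of_le (s : unitInterval) {t : ℝ≥0} (ht : 1 + Real.toNNReal s ≤ t) :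
    trianglePoint s t = stdSimplex.vertex 2 := by
  have ht : (1 : ℝ) + s ≤ t := by
    have := NNReal.coe_le_coe.2 ht
    simpa [Real.coe_toNNReal _ s.2.1] using this
  have h₁ : min (t : ℝ) 1 = 1 := min_eq_right (by linarith [s.2.1])
  have h₂ : min (max ((t : ℝ) - s) 0) 1 = 1 := min_eq_right (le_max_of_le_left (by linarith))
  ext i
  fin_cases i <;> simp [trianglePoint, h₁, h₂] <;> rfl

lemma trianglePoint_zero_left (t : ℝ≥0) :
    trianglePoint 0 t = stdSimplex.map (Fin.succAbove 1) (edgePoint t) := by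
  ext i
  fin_cases i <;>
    simp [trianglePoint, edgePoint, FunOnFinite.linearMap_apply_apply, Finset.sum_filter,
      Fin.sum_univ_two] <;> rfl

lemma trianglePoint_one_left_of_le {t : ℝ≥0} (ht : t ≤ 1) :
    trianglePoint 1 t = stdSimplex.map (fun i : Fin 2 => (⟨i, by omega⟩ : Fin 3)) (edgePoint t) := by
  have h : (t : ℝ) ≤ 1 := ht
  ext i
  fin_cases i <;>
    simp [trianglePoint, edgePoint, FunOnFinite.linearMap_apply_apply, Finset.sum_filter,
      Fin.sum_univ_two, h] <;> rfl

lemma trianglePoint_one_left_of_ge {t : ℝ≥0} (ht : 1 ≤ t) :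
    trianglePoint 1 t =
      stdSimplex.map (fun i : Fin 2 => (⟨1 + i, by omega⟩ : Fin 3)) (edgePoint (t - 1)) := by
  have h : (1 : ℝ) ≤ t := ht
  have h' : ((t - 1 : ℝ≥0) : ℝ) = t - 1 := NNReal.coe_sub ht
  ext i
  fin_cases i <;>
    simp [trianglePoint, edgePoint, FunOnFinite.linearMap_apply_apply, Finset.sum_filter,
      Fin.sum_univ_two, h, h'] <;> rfl

/-- The family of Moore loops of length `1 + s` given by a pointed `2`-simplex. -/
def PSimplex.triangleLoop (σ : PSimplex X b 2) (s : unitInterval) : MooreLoop X b :=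
  ⟨(σ.1.comp ⟨trianglePoint s, continuous_trianglePoint.comp (Continuous.prodMk_right s)⟩,
    1 + Real.toNNReal s),
    (congrArg σ.1 (trianglePoint_zero s)).trans (σ.2 0),
    fun _ ht => (congrArg σ.1 (trianglePoint_of_le s ht)).trans (σ.2 2)⟩

lemma PSimplex.continuous_triangleLoop (σ : PSimplex X b 2) : Continuous σ.triangleLoop :=
  MooreLoop.continuous_mk _ (σ.1.continuous.comp continuous_trianglePoint) <| by
    change Continuous fun s : unitInterval => 1 + Real.toNNReal s
    fun_prop

lemma PSimplex.triangleLoop_zero (σ : PSimplex X b 2) : σ.triangleLoop 0 = (σ.face 1).loop := by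
  refine MooreLoop.ext (fun t => congrArg σ.1 (trianglePoint_zero_left t)) ?_
  change 1 + Real.toNNReal ((0 : unitInterval) : ℝ) = 1
  simp

lemma PSimplex.triangleLoop_one (σ : PSimplex X b 2) : σ.triangleLoop 1 =
    (σ.front (p := 1) (q := 1) rfl).loop * (σ.back (p := 1) (q := 1) rfl).loop := by
  refine MooreLoop.ext (fun t => ?_) ?_
  · rw [MooreLoop.mul_toMap]
    split_ifs with h
    · exact congrArg σ.1 (trianglePoint_one_left_of_le h)
    · exact congrArg σ.1 (trianglePoint_one_left_of_ge (not_le.1 h).le)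
  · change 1 + Real.toNNReal ((1 : unitInterval) : ℝ) = 1 + 1
    simp

lemma PSimplex.loop_of_isDegenerate {σ : PSimplex X b 1} (h : σ.IsDegenerate) (t : ℝ≥0) :
    σ.loop.toMap t = b := by
  obtain ⟨j, τ, rfl⟩ := h
  refine Eq.trans (congrArg τ.1 ?_) (τ.2 0)
  exact Subsingleton.elim _ _

/-- The constant loop of length `s`. -/
def constLoop (X : Type u) [TopologicalSpace X] (b : X) (s : unitInterval) : MooreLoop X b :=
  ⟨(ContinuousMap.const _ b, Real.toNNReal s), by simp⟩

lemma continuous_constLoop : Continuous (constLoop X b) :=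
  MooreLoop.continuous_mk _ continuous_const <| by
    change Continuous fun s : unitInterval => Real.toNNReal s
    fun_prop

/-- The algebra `C^□_*(Ω_b X; ℚ)` of normalized singular cubical chains on the Moore loops. -/
abbrev LoopChains (X : Type u) [TopologicalSpace X] (b : X) : Type u := CubeChains (MooreLoop X b)

/-- The zeroth homology algebra of the space of Moore loops. -/
abbrev H0Loops (X : Type u) [TopologicalSpace X] (b : X) : Type u :=
  H0 (cubeGr (MooreLoop X b)) (cubeD (MooreLoop X b))

lemma pointClass_face (σ : PSimplex X b 2) : pointClass (σ.face 1).loop =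
    pointClass (σ.front (p := 1) (q := 1) rfl).loop *
      pointClass (σ.back (p := 1) (q := 1) rfl).loop := by
  rw [← pointClass_mul, ← σ.triangleLoop_zero, ← σ.triangleLoop_one]
  exact pointClass_eq_of_path ⟨_, σ.continuous_triangleLoop⟩

lemma pointClass_of_isDegenerate {σ : PSimplex X b 1} (h : σ.IsDegenerate) :
    pointClass σ.loop = 1 := by
  have h₀ : constLoop X b 0 = 1 := MooreLoop.ext (fun _ => rfl) (by
    change Real.toNNReal ((0 : unitInterval) : ℝ) = 0
    simp)
  have h₁ : constLoop X b 1 = σ.loop :=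
    MooreLoop.ext (fun t => (PSimplex.loop_of_isDegenerate h t).symm) (by
      change Real.toNNReal ((1 : unitInterval) : ℝ) = 1
      simp)
  rw [← h₁, ← pointClass_one, ← h₀]
  exact (pointClass_eq_of_path ⟨_, continuous_constLoop⟩).symm

/-- Auxiliary: the map from the cobar construction which is zero in positive degrees and sends `[σ]`
to the class of the loop of `σ` minus `1`. -/
def cobarToLoops (X : Type u) [TopologicalSpace X] (b : X) : Cobar X b →ₐ[ℚ] H0Loops X b :=
  TA.lift fun n => match n with
    | 0 => NChain.lift (fun σ => pointClass σ.loop - 1) fun σ h => by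
        rw [pointClass_of_isDegenerate h, sub_self]
    | _ + 1 => 0

lemma cobarToLoops_edge (σ : PSimplex X b 1) :
    cobarToLoops X b (cubeGen σ) = pointClass σ.loop := by
  rw [cubeGen, map_add, map_one, cobarGen, cobarToLoops, TA.lift_gen, NChain.lift_of]
  abel

lemma cobarToLoops_gen {n : ℕ} (σ : PSimplex X b (n + 2)) :
    cobarToLoops X b (cobarGen σ) = 0 := by
  rw [cobarGen, cobarToLoops, TA.lift_gen]
  rfl

/-- The map `H₀(Ω C_*(X, b; ℚ)) → H₀(Ω_b X; ℚ)` induced by Adams' map `θ`: since `θ` sends the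
generator `[σ]` of a pointed `1`-simplex to the loop of `σ` minus the unit loop, up to a boundary,
`H₀(θ)` sends the class of `1 + [σ]` to the class of the loop of `σ`. -/
def H0theta (X : Type u) [TopologicalSpace X] (b : X) : H0Cobar X b →ₐ[ℚ] H0Loops X b :=
  H0.lift ((cobarToLoops X b).comp (cycles₀ (cobarGr X b) (cobarD X b)).val) <| by
    intro z c _ hc
    have := comp_cobarD_eq_zero (cobarToLoops X b) (fun n σ => cobarToLoops_gen σ)
      (fun σ => by rw [cobarToLoops_edge, cobarToLoops_edge, cobarToLoops_edge, pointClass_face]) c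
    rw [AlgHom.comp_apply, Subalgebra.coe_val, ← hc]
    exact this

lemma H0theta_edge (σ : PSimplex X b 1) : H0theta X b (edge σ) = pointClass σ.loop :=
  cobarToLoops_edge σ

/-- A morphism of differential graded algebras `θ : Ω C_*(X, b; ℚ) → C^□_*(Ω_b X; ℚ)` extends the
first step of Adams' construction if, up to boundaries, it sends the generator `[σ]` of a pointed
`1`-simplex to the loop of `σ` minus the unit loop. -/
structure IsAdamsMap (θ : Cobar X b →ₐ[ℚ] LoopChains X b) : Prop
    extends IsDGHom (cobarGr X b) (cobarD X b) (cubeGr (MooreLoop X b)) (cubeD (MooreLoop X b)) θ where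
  edge : ∀ σ : PSimplex X b 1, ∃ c ∈ cubeGr (MooreLoop X b) 1,
    cubeD (MooreLoop X b) c = θ (cobarGen σ) - (CubeChains.of (Cube.point σ.loop) - 1)

lemma Pi1.map_mk {Y : Type u} [TopologicalSpace Y] {c : Y} (f : C(X, Y)) (hf : f b = c)
    (p : Path b b) :
    Pi1.map f hf (Pi1.mk p) = Pi1.mk ((p.map f.continuous).cast hf.symm hf.symm) := by
  subst hf
  simp [Pi1.map, Pi1.mk, MonoidHom.op, FundamentalGroup.mapOfEq_apply]
  rfl

end Moore

end

end LoopCobar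

open LoopCobar

/-!
By the relations coming from `2`-simplices, sending a loop to the class of its `1`-simplex defines
an algebra map `ℚ[π₁(X, b)] → H₀(Ω C_*)`: a homotopy, restricted to the two triangles of a square,
relates its ends through the diagonal. On the other side, taking homotopy classes of Moore loops
gives `H₀(Ω_b X) → ℚ[π₁(X, b)]`, since points span `H₀` of the cubical chains and paths of Moore
loops are homotopies. Together with `H₀(θ)` these maps form a cycle
`ℚ[π₁(X, b)] → H₀(Ω C_*) → H₀(Ω_b X) → ℚ[π₁(X, b)]`
whose three composites are the identity on generators, so all three are isomorphisms. The classes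
of `1`-simplices in `H₀(Ω C_*)` are group-like, hence the isomorphism with the group algebra
respects the coalgebra structures. The antipode and the group-like elements are then transported
from the group algebra, whose group-like elements are the elements of the group.
-/

namespace LoopCobar

noncomputable section

section BialgebraTransport

variable {R A B : Type*}

/-- The Hopf algebra structure on a bialgebra obtained by transporting the antipode along an
isomorphism of bialgebras; the underlying bialgebra structure is unchanged. -/
abbrev hopfAlgebraOfBialgEquiv [CommSemiring R] [Semiring A] [Bialgebra R A] [Semiring B]
    [HopfAlgebra R B] (e : A ≃ₐc[R] B) : HopfAlgebra R A where
  antipode := (e.symm : B →ₗ[R] A) ∘ₗ HopfAlgebraStruct.antipode R ∘ₗ (e : A →ₗ[R] B)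
  mul_antipode_rTensor_comul := LinearMap.ext fun a => e.injective <| by
    have h := HopfAlgebra.mul_antipode_rTensor_comul_apply (R := R) (e a)
    rw [← CoalgHomClass.map_comp_comul_apply, CoalgHomClass.counit_comp_apply] at h
    refine Eq.trans ?_ (h.trans (AlgHomClass.commutes e _).symm)
    change ((e : A →ₗ[R] B) ∘ₗ LinearMap.mul' R A ∘ₗ LinearMap.rTensor A _) _ =
      (LinearMap.mul' R B ∘ₗ LinearMap.rTensor B _ ∘ₗ TensorProduct.map _ _) _
    congr 1
    ext x y
    simp
  mul_antipode_lTensor_comul := LinearMap.ext fun a => e.injective <| by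
    have h := HopfAlgebra.mul_antipode_lTensor_comul_apply (R := R) (e a)
    rw [← CoalgHomClass.map_comp_comul_apply, CoalgHomClass.counit_comp_apply] at h
    refine Eq.trans ?_ (h.trans (AlgHomClass.commutes e _).symm)
    change ((e : A →ₗ[R] B) ∘ₗ LinearMap.mul' R A ∘ₗ LinearMap.lTensor A _) _ =
      (LinearMap.mul' R B ∘ₗ LinearMap.lTensor B _ ∘ₗ TensorProduct.map _ _) _
    congr 1
    ext x y
    simp

variable [CommSemiring R] [Semiring A] [Bialgebra R A] [Semiring B] [Bialgebra R B]

/-- An isomorphism of bialgebras identifies the monoids of group-like elements. -/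
def groupLikeCongr (e : A ≃ₐc[R] B) : GroupLike R A ≃* GroupLike R B where
  toFun a := ⟨e a.val, a.isGroupLikeElem_val.map e⟩
  invFun b := ⟨e.symm b.val, b.isGroupLikeElem_val.map e.symm⟩
  left_inv a := GroupLike.val_injective (e.symm_apply_apply a.val)
  right_inv b := GroupLike.val_injective (e.apply_symm_apply b.val)
  map_mul' a a' := GroupLike.val_injective (map_mul e a.val a'.val)

end BialgebraTransport

section GroupAlgebra

variable (R G : Type*) [CommRing R] [IsDomain R] [Monoid G]

/-- The group-like elements of a monoid algebra over a domain are the elements of the monoid. -/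
def groupLikeMonoidAlgebra : G ≃* GroupLike R (MonoidAlgebra R G) :=
  let f : G →* GroupLike R (MonoidAlgebra R G) :=
    { toFun g := ⟨MonoidAlgebra.of R G g, MonoidAlgebra.isGroupLikeElem_of g⟩
      map_one' := GroupLike.val_injective (map_one (MonoidAlgebra.of R G))
      map_mul' g h := GroupLike.val_injective (map_mul (MonoidAlgebra.of R G) g h) }
  MulEquiv.ofBijective f
    ⟨fun _ _ h => MonoidAlgebra.of_injective (congrArg GroupLike.val h), fun x => by
      obtain ⟨g, hg⟩ := MonoidAlgebra.isGroupLikeElem_iff_mem_range_of.1 x.isGroupLikeElem_val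
      exact ⟨g, GroupLike.val_injective hg⟩⟩

end GroupAlgebra

section CubicalH0

variable {M : Type u} [TopologicalSpace M]

lemma Cube.exists_eq_point {a : Cube M} (ha : a.dim = 0) : ∃ x, a = Cube.point x :=
  ⟨a.ev 0, Cube.ext_ev ha fun _ => Cube.ev_congr a fun k hk => by omega⟩

lemma Cube.exists_eq_path {a : Cube M} (ha : a.dim = 1) : ∃ p, a = Cube.path p := by
  obtain ⟨n, f⟩ := a
  obtain rfl : n = 1 := ha
  refine ⟨f.comp ⟨fun s _ => s, by fun_prop⟩, ?_⟩
  congr 1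
  ext x
  exact congrArg f (funext fun i => congrArg x (Subsingleton.elim i 0))

variable [Monoid M] [ContinuousMul M]

lemma cubeD_of_path (p : C(unitInterval, M)) : cubeD M (CubeChains.of (Cube.path p)) =
    CubeChains.of (Cube.point (p 1)) - CubeChains.of (Cube.point (p 0)) := by
  have h : cubeBd (Cube.path p) = ∑ i ∈ Finset.range 1, (-1 : ℚ) ^ i •
    (CubeChains.of ((Cube.path p).face i 1) - CubeChains.of ((Cube.path p).face i 0)) := rfl
  rw [cubeD_of, h, Finset.sum_range_one, pow_zero, one_smul, Cube.path_face, Cube.path_face]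

lemma span_range_pointClass :
    Submodule.span ℚ (Set.range (pointClass : M → H0 (cubeGr M) (cubeD M))) = ⊤ := by
  refine eq_top_iff.2 fun x _ => ?_
  obtain ⟨⟨z, hz, hdz⟩, rfl⟩ := H0.mk_surjective _ _ x
  suffices h : H0.mk (cubeGr M) (cubeD M) (cycle _ _ z hz) ∈
    Submodule.span ℚ (Set.range (pointClass : M → H0 (cubeGr M) (cubeD M))) from h
  clear * - z hz
  induction hz using Submodule.span_induction with
  | zero => exact zero_mem _
  | add x y hx hy ihx ihy => exact add_mem ihx ihy
  | smul r x hx ih => exact Submodule.smul_mem _ r ih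
  | mem x hx =>
    obtain ⟨a, ha, rfl⟩ := hx
    obtain ⟨m, rfl⟩ := Cube.exists_eq_point ha
    exact Submodule.subset_span ⟨m, rfl⟩

/-- The extension of a homomorphism `φ` on the points of `M` to the monoid of cubes by zero in
positive dimensions. -/
def Cube.extendPoints {N : Type*} [MonoidWithZero N] (φ : M →* N) : Cube M →* N where
  toFun a := if a.dim = 0 then φ (a.ev 0) else 0
  map_one' := by rw [if_pos Cube.one_dim]; exact map_one φ
  map_mul' a c := by
    by_cases ha : a.dim = 0
    · by_cases hc : c.dim = 0
      · rw [if_pos ha, if_pos hc, if_pos (by rw [Cube.mul_dim, ha, hc]), ← map_mul]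
        rfl
      · rw [if_neg hc, if_neg (by rw [Cube.mul_dim]; omega), mul_zero]
    · rw [if_neg ha, if_neg (by rw [Cube.mul_dim]; omega), zero_mul]

lemma Cube.extendPoints_of_isDegenerate {N : Type*} [MonoidWithZero N] (φ : M →* N)
    {a : Cube M} (ha : a.IsDegenerate) : Cube.extendPoints φ a = 0 := by
  obtain ⟨i, -⟩ := ha
  exact if_neg i.pos.ne'

lemma Cube.extendPoints_point {N : Type*} [MonoidWithZero N] (φ : M →* N) (x : M) :
    Cube.extendPoints φ (Cube.point x) = φ x :=
  rfl

variable {W : Type*} [Ring W] [Algebra ℚ W]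

lemma algHom_ext_pointClass {f g : H0 (cubeGr M) (cubeD M) →ₐ[ℚ] W}
    (h : ∀ x, f (pointClass x) = g (pointClass x)) : f = g :=
  AlgHom.toLinearMap_injective (LinearMap.ext_on_range span_range_pointClass h)

/-- The algebra map on normalized cubical chains which is `φ` on points and vanishes on cubes of
positive dimension. -/
def CubeChains.extendPoints (φ : M →* W) : CubeChains M →ₐ[ℚ] W :=
  Ideal.Quotient.liftₐ (degenerateCubes M) (MonoidAlgebra.lift ℚ W (Cube M) (Cube.extendPoints φ))
    fun x hx => by
      rw [mem_degenerateCubes] at hx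
      induction hx using Submodule.span_induction with
      | zero => exact map_zero _
      | add x y _ _ hx hy => rw [map_add, hx, hy, add_zero]
      | smul r x _ hx => rw [map_smul, hx, smul_zero]
      | mem x hx =>
        obtain ⟨a, ha, rfl⟩ := hx
        rw [MonoidAlgebra.lift_single, Cube.extendPoints_of_isDegenerate φ ha, smul_zero]

lemma CubeChains.extendPoints_of (φ : M →* W) (a : Cube M) :
    CubeChains.extendPoints φ (CubeChains.of a) = Cube.extendPoints φ a :=
  (MonoidAlgebra.lift_single ..).trans (one_smul _ _)

lemma CubeChains.extendPoints_of_point (φ : M →* W) (x : M) :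
    CubeChains.extendPoints φ (CubeChains.of (Cube.point x)) = φ x :=
  (CubeChains.extendPoints_of φ _).trans (Cube.extendPoints_point φ x)

lemma CubeChains.extendPoints_cubeD {φ : M →* W} (hφ : ∀ p : C(unitInterval, M), φ (p 0) = φ (p 1))
    {c : CubeChains M} (hc : c ∈ cubeGr M 1) : CubeChains.extendPoints φ (cubeD M c) = 0 := by
  induction hc using Submodule.span_induction with
  | zero => rw [map_zero, map_zero]
  | add x y _ _ hx hy => rw [map_add, map_add, hx, hy, add_zero]
  | smul r x _ hx => rw [map_smul, map_smul, hx, smul_zero]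
  | mem x hx =>
    obtain ⟨a, ha, rfl⟩ := hx
    obtain ⟨p, rfl⟩ := Cube.exists_eq_path ha
    rw [cubeD_of_path, map_sub, extendPoints_of_point, extendPoints_of_point, hφ p, sub_self]

/-- The universal property of `H₀` of the cubical chains: a monoid homomorphism which is constant
along paths extends to an algebra map. -/
def pointClassLift (φ : M →* W) (hφ : ∀ p : C(unitInterval, M), φ (p 0) = φ (p 1)) :
    H0 (cubeGr M) (cubeD M) →ₐ[ℚ] W :=
  H0.lift ((CubeChains.extendPoints φ).comp (cycles₀ _ _).val) fun _ _ hc hz =>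
    (congrArg _ hz.symm).trans (CubeChains.extendPoints_cubeD hφ hc)

lemma pointClassLift_pointClass (φ : M →* W)
    (hφ : ∀ p : C(unitInterval, M), φ (p 0) = φ (p 1)) (x : M) :
    pointClassLift φ hφ (pointClass x) = φ x :=
  CubeChains.extendPoints_of_point φ x

end CubicalH0

section Loops

/-- The `i`-th barycentric coordinate of a point of a simplex, as a point of the unit interval. -/
def baryCoord {n : ℕ} (i : Fin n) : C(stdSimplex ℝ (Fin n), unitInterval) :=
  ⟨fun x => ⟨x i, mem_Icc_of_mem_stdSimplex x.2 i⟩,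
    ((continuous_apply i).comp continuous_subtype_val).subtype_mk _⟩

lemma baryCoord_vertex {n : ℕ} (i j : Fin (n + 1)) :
    baryCoord i (stdSimplex.vertex j) = if i = j then 1 else 0 :=
  Subtype.ext <| (Pi.single_apply j 1 i).trans <| by split_ifs <;> rfl

lemma baryCoord_map_of_injective {m n : ℕ} {f : Fin (m + 1) → Fin (n + 1)}
    (hf : Function.Injective f) (i : Fin (m + 1)) (x : stdSimplex ℝ (Fin (m + 1))) :
    baryCoord (f i) (stdSimplex.map f x) = baryCoord i x := by
  refine Subtype.ext ?_
  simp [baryCoord, FunOnFinite.linearMap_apply_apply, hf.eq_iff, Finset.filter_eq']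

lemma baryCoord_map_of_forall_ne {m n : ℕ} {f : Fin (m + 1) → Fin (n + 1)} {j : Fin (n + 1)}
    (hj : ∀ i, f i ≠ j) (x : stdSimplex ℝ (Fin (m + 1))) :
    baryCoord j (stdSimplex.map f x) = 0 := by
  refine Subtype.ext ?_
  simp [baryCoord, FunOnFinite.linearMap_apply_apply, hj]

lemma baryCoord_zero_eq_symm (x : stdSimplex ℝ (Fin 2)) :
    baryCoord 0 x = unitInterval.symm (baryCoord 1 x) := by
  refine Subtype.ext (eq_sub_of_add_eq ?_)
  have sum_eq := x.2.2
  rw [Fin.sum_univ_two] at sum_eq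
  exact sum_eq

variable {X : Type u} [TopologicalSpace X] {b : X}

/-- The pointed `1`-simplex which runs along a loop. -/
def PSimplex.ofPath (p : Path b b) : PSimplex X b 1 :=
  ⟨p.toContinuousMap.comp (baryCoord 1), fun i => by
    fin_cases i <;> simp [baryCoord_vertex]⟩

/-- The pointed `2`-simplex obtained by restricting a map on the square to the triangle with
vertices `(0, 0)`, `(1, 0)` and `(0, 1)`. -/
def PSimplex.ofSquare (F : C(unitInterval × unitInterval, X)) (h₀ : F (0, 0) = b)
    (h₁ : F (1, 0) = b) (h₂ : F (0, 1) = b) : PSimplex X b 2 :=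
  ⟨F.comp ((baryCoord 1).prodMk (baryCoord 2)), fun i => by
    fin_cases i <;> simp [baryCoord_vertex, h₀, h₁, h₂]⟩

lemma edge_ofPath_eq_mul_of_square {p q r : Path b b} (F : C(unitInterval × unitInterval, X))
    (hp : ∀ t, F (t, 0) = p t) (hq : ∀ t, F (unitInterval.symm t, t) = q t)
    (hr : ∀ t, F (0, t) = r t) :
    edge (PSimplex.ofPath r) = edge (PSimplex.ofPath p) * edge (PSimplex.ofPath q) := by
  let σ := PSimplex.ofSquare F ((hp 0).trans p.source) ((hp 1).trans p.target)
    ((hr 1).trans r.target)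
  have front_eq : σ.front (p := 1) (q := 1) rfl = PSimplex.ofPath p := by
    refine Subtype.ext <| ContinuousMap.ext fun x => Eq.trans (congrArg F (Prod.ext ?_ ?_)) (hp _)
    · exact baryCoord_map_of_injective (fun i j h => by grind) 1 x
    · exact baryCoord_map_of_forall_ne (by decide) x
  have back_eq : σ.back (p := 1) (q := 1) rfl = PSimplex.ofPath q := by
    refine Subtype.ext <| ContinuousMap.ext fun x => Eq.trans (congrArg F (Prod.ext ?_ ?_)) (hq _)
    · exact (baryCoord_map_of_injective (fun i j h => by grind) 0 x).trans
        (baryCoord_zero_eq_symm x)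
    · exact baryCoord_map_of_injective (fun i j h => by grind) 1 x
  have face_eq : σ.face 1 = PSimplex.ofPath r := by
    refine Subtype.ext <| ContinuousMap.ext fun x => Eq.trans (congrArg F (Prod.ext ?_ ?_)) (hr _)
    · exact baryCoord_map_of_forall_ne (Fin.succAbove_ne 1) x
    · exact baryCoord_map_of_injective Fin.succAbove_right_injective 1 x
  rw [← face_eq, ← front_eq, ← back_eq, edge_face]

lemma edge_of_isDegenerate {σ : PSimplex X b 1} (h : σ.IsDegenerate) : edge σ = 1 := by
  rw [← cobarPi_cubeGen, cubeGen, cobarGen_eq_zero h, add_zero, map_one]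

lemma edge_ofPath_refl : edge (PSimplex.ofPath (Path.refl b)) = 1 :=
  edge_of_isDegenerate ⟨0, ⟨ContinuousMap.const _ b, fun _ => rfl⟩, rfl⟩

lemma edge_ofPath_trans (p q : Path b b) : edge (PSimplex.ofPath (p.trans q)) =
    edge (PSimplex.ofPath p) * edge (PSimplex.ofPath q) := by
  refine edge_ofPath_eq_mul_of_square
    ⟨fun x => (p.trans q).extend (x.1 / 2 + x.2), by fun_prop⟩ (fun t => ?_) (fun t => ?_)
    fun t => ?_
  · have ht : (t / 2 : ℝ) ≤ 1 / 2 := by linarith [t.2.2]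
    simp [Path.extend_trans_of_le_half p q ht, mul_div_cancel₀]
  · have ht : (1 / 2 : ℝ) ≤ (1 - t) / 2 + t := by linarith [t.2.1]
    have h : 2 * ((1 - t) / 2 + t) - 1 = (t : ℝ) := by ring
    simp [Path.extend_trans_of_half_le p q ht, h]
  · simp

lemma edge_ofPath_eq_of_homotopic {p q : Path b b} (h : p.Homotopic q) :
    edge (PSimplex.ofPath p) = edge (PSimplex.ofPath q) := by
  obtain ⟨H⟩ := h
  let diagonal : Path b b := ⟨⟨fun t => H (t, t), by fun_prop⟩, by simp, by simp⟩
  let clampedSum (x : unitInterval × unitInterval) : unitInterval :=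
    Set.projIcc 0 1 zero_le_one (x.1 + x.2 : ℝ)
  have continuous_clampedSum : Continuous clampedSum := by fun_prop
  have hp := edge_ofPath_eq_mul_of_square (p := p) (q := Path.refl b) (r := diagonal)
    ⟨fun x => H (x.2, clampedSum x), by fun_prop⟩
    (fun t => by simp [clampedSum]) (fun t => by simp [clampedSum])
    (fun t => by simp [clampedSum, diagonal])
  have hq := edge_ofPath_eq_mul_of_square (p := Path.refl b) (q := q) (r := diagonal)
    ⟨fun x => H (clampedSum x, x.2), by fun_prop⟩
    (fun t => by simp [clampedSum]) (fun t => by simp [clampedSum])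
    (fun t => by simp [clampedSum, diagonal])
  rw [edge_ofPath_refl, mul_one] at hp
  rw [edge_ofPath_refl, one_mul] at hq
  rw [← hp, hq]

lemma Pi1.mk_surjective : Function.Surjective (Pi1.mk : Path b b → Pi1 X b) := fun g => by
  obtain ⟨p, hp⟩ := Path.Homotopic.Quotient.mk_surjective (FundamentalGroup.toPath g.unop)
  exact ⟨p, congrArg (fun x => MulOpposite.op (FundamentalGroup.fromPath x)) hp⟩

lemma Pi1.mk_eq_of_homotopic {p q : Path b b} (h : p.Homotopic q) : Pi1.mk p = Pi1.mk q :=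
  congrArg (fun x => MulOpposite.op (FundamentalGroup.fromPath x)) (Quotient.sound h)

variable (X b) in
/-- The homomorphism from the fundamental group to `H₀(Ω C_*(X, b; ℚ))` sending the class of a loop
to the class of the corresponding `1`-simplex. -/
def Pi1.toH0Cobar : Pi1 X b →* H0Cobar X b where
  toFun g := Quotient.lift (fun p : Path b b => edge (PSimplex.ofPath p))
    (fun _ _ => edge_ofPath_eq_of_homotopic) (FundamentalGroup.toPath g.unop)
  map_one' := edge_ofPath_refl
  map_mul' g h := by
    obtain ⟨p, rfl⟩ := Pi1.mk_surjective g
    obtain ⟨q, rfl⟩ := Pi1.mk_surjective h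
    exact edge_ofPath_trans p q

end Loops

section MooreLoops

variable {X : Type u} [TopologicalSpace X] {b : X}

lemma MooreLoop.continuous_toPath {T : Type*} [TopologicalSpace T] {f : T → MooreLoop X b}
    {s : T → unitInterval} (hf : Continuous f) (hs : Continuous s) :
    Continuous fun t => (f t).toPath (s t) :=
  (continuous_toMap.comp hf).eval ((continuous_length.comp hf).mul
    (continuous_real_toNNReal.comp (continuous_subtype_val.comp hs)))

lemma MooreLoop.homotopic_toPath_of_path (Γ : C(unitInterval, MooreLoop X b)) :
    (Γ 0).toPath.Homotopic (Γ 1).toPath :=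
  ⟨{toFun x := (Γ x.1).toPath x.2
    continuous_toFun := continuous_toPath (Γ.continuous.comp continuous_fst) continuous_snd
    map_zero_left _ := rfl
    map_one_left _ := rfl
    prop' s t ht := by rcases ht with rfl | rfl <;> simp }⟩

lemma MooreLoop.homotopic_of_reparam (γ : MooreLoop X b) {p q : Path b b}
    {φ ψ : C(unitInterval, ℝ≥0)} (hφ₀ : φ 0 = 0) (hψ₀ : ψ 0 = 0) (hφ₁ : γ.length ≤ φ 1)
    (hψ₁ : γ.length ≤ ψ 1) (hp : ∀ t, p t = γ.toMap (φ t)) (hq : ∀ t, q t = γ.toMap (ψ t)) :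
    p.Homotopic q :=
  ⟨{toFun x := γ.toMap (Real.toNNReal (1 - x.1) * φ x.2 + Real.toNNReal x.1 * ψ x.2)
    continuous_toFun := by fun_prop
    map_zero_left t := by simp [hp]
    map_one_left t := by simp [hq]
    prop' s t ht := by
      rcases ht with rfl | rfl
      · simp [hφ₀, hψ₀, toMap_zero]
      · have weights_sum : Real.toNNReal (1 - s) + Real.toNNReal s = 1 := by
          rw [← Real.toNNReal_add (sub_nonneg.2 s.2.2) s.2.1, sub_add_cancel, Real.toNNReal_one]
        refine (toMap_of_length_le γ ?_).trans p.target.symm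
        calc γ.length = Real.toNNReal (1 - s) * γ.length + Real.toNNReal s * γ.length := by
              rw [← add_mul, weights_sum, one_mul]
          _ ≤ Real.toNNReal (1 - s) * φ 1 + Real.toNNReal s * ψ 1 := by gcongr }⟩

lemma MooreLoop.mul_toMap_of_le (γ δ : MooreLoop X b) {t : ℝ≥0} (ht : t ≤ γ.length) :
    (γ * δ).toMap t = γ.toMap t :=
  if_pos ht

lemma MooreLoop.mul_toMap_length_add (γ δ : MooreLoop X b) (t : ℝ≥0) :
    (γ * δ).toMap (γ.length + t) = δ.toMap t := by
  rcases eq_or_ne t 0 with rfl | ht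
  · rw [add_zero, mul_toMap_of_le γ δ le_rfl, toMap_of_length_le γ le_rfl, toMap_zero]
  · rw [mul_toMap, if_neg (by simpa using ht), add_tsub_cancel_left]

lemma MooreLoop.homotopic_toPath_mul (γ δ : MooreLoop X b) :
    (γ * δ).toPath.Homotopic (γ.toPath.trans δ.toPath) := by
  refine (γ * δ).homotopic_of_reparam
    (φ := ⟨fun t => (γ * δ).length * Real.toNNReal t, by fun_prop⟩)
    (ψ := ⟨fun t => γ.length * min (Real.toNNReal (2 * t)) 1 +
      δ.length * Real.toNNReal (2 * t - 1), by fun_prop⟩)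
    (by simp) (by simp) (by simp) (by norm_num [mul_length]) (fun _ => rfl) fun t => ?_
  simp only [Path.trans_apply, ContinuousMap.coe_mk]
  split_ifs with ht
  · have h₁ : Real.toNNReal (2 * t) ≤ 1 := Real.toNNReal_le_one.2 (by linarith)
    have h₂ : Real.toNNReal (2 * t - 1) = 0 := Real.toNNReal_of_nonpos (by linarith)
    rw [min_eq_left h₁, h₂, mul_zero, add_zero, mul_toMap_of_le γ δ (mul_le_of_le_one_right' h₁)]
    rfl
  · have h₁ : 1 ≤ Real.toNNReal (2 * t) := Real.one_le_toNNReal.2 (by linarith)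
    rw [min_eq_right h₁, mul_one, mul_toMap_length_add]
    rfl

variable (X b) in
/-- The homomorphism from the monoid of Moore loops to the fundamental group. -/
def Pi1.ofMooreLoop : MooreLoop X b →* Pi1 X b where
  toFun γ := Pi1.mk γ.toPath
  map_one' := congrArg Pi1.mk (Path.ext rfl : (1 : MooreLoop X b).toPath = Path.refl b)
  map_mul' γ δ := Pi1.mk_eq_of_homotopic (γ.homotopic_toPath_mul δ)

/-- The deformation of a Moore loop `γ` of length `r` to length `1`: at time `s` the length is
`(1 - s) * r + s` and the speed is `(1 - s) + s * r`. Their product is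
`r + s * (1 - s) * (r - 1) ^ 2 ≥ r`, so that the loop closes up. -/
def MooreLoop.rescale (γ : MooreLoop X b) (s : unitInterval) : MooreLoop X b :=
  ⟨(γ.toMap.comp ⟨fun t => t * (Real.toNNReal (1 - s) + Real.toNNReal s * γ.length), by fun_prop⟩,
    Real.toNNReal (1 - s) * γ.length + Real.toNNReal s), by simp [toMap_zero], fun t ht => by
    refine toMap_of_length_le _ (le_trans ?_ (mul_le_mul_left ht _))
    rw [← NNReal.coe_le_coe]
    simp only [NNReal.coe_mul, NNReal.coe_add, Real.coe_toNNReal _ s.2.1,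
      Real.coe_toNNReal _ (sub_nonneg.2 s.2.2)]
    nlinarith [mul_nonneg (mul_nonneg s.2.1 (sub_nonneg.2 s.2.2)) (sq_nonneg ((γ.length : ℝ) - 1))]⟩

lemma MooreLoop.rescale_toMap (γ : MooreLoop X b) (s : unitInterval) (t : ℝ≥0) :
    (γ.rescale s).toMap t =
      γ.toMap (t * (Real.toNNReal (1 - s) + Real.toNNReal s * γ.length)) := rfl

lemma MooreLoop.rescale_length (γ : MooreLoop X b) (s : unitInterval) :
    (γ.rescale s).length = Real.toNNReal (1 - s) * γ.length + Real.toNNReal s := rfl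

lemma MooreLoop.continuous_rescale (γ : MooreLoop X b) : Continuous γ.rescale :=
  continuous_mk _ (by simp only [rescale_toMap]; fun_prop)
    (by simp only [rescale_length]; fun_prop)

lemma MooreLoop.rescale_zero (γ : MooreLoop X b) : γ.rescale 0 = γ :=
  ext (fun t => by simp [rescale_toMap]) (by simp [rescale_length])

lemma edgePoint_baryCoord_one (x : stdSimplex ℝ (Fin 2)) :
    edgePoint (Real.toNNReal (baryCoord 1 x)) = x := by
  have h : min (Real.toNNReal (baryCoord 1 x) : ℝ) 1 = baryCoord 1 x := by
    rw [Real.coe_toNNReal _ (baryCoord 1 x).2.1, min_eq_left (baryCoord 1 x).2.2]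
  refine stdSimplex.ext (funext fun i => ?_)
  fin_cases i
  · exact (congrArg (1 - ·) h).trans (congrArg Subtype.val (baryCoord_zero_eq_symm x)).symm
  · exact h

lemma PSimplex.loop_length (σ : PSimplex X b 1) : σ.loop.length = 1 := rfl

lemma MooreLoop.rescale_one (γ : MooreLoop X b) :
    γ.rescale 1 = (PSimplex.ofPath γ.toPath).loop := by
  refine ext (fun t => ?_) (by simp [rescale_length, PSimplex.loop_length])
  change _ = γ.toMap (γ.length * Real.toNNReal (min (t : ℝ) 1))
  rcases le_total t 1 with ht | ht
  · have ht' : (t : ℝ) ≤ 1 := ht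
    simp [rescale_toMap, ht', mul_comm]
  · have ht' : (1 : ℝ) ≤ t := ht
    rw [min_eq_right ht', rescale_toMap, toMap_of_length_le γ, toMap_of_length_le γ (by simp)]
    simpa using le_mul_of_one_le_left' ht

lemma pointClass_loop_ofPath (γ : MooreLoop X b) :
    pointClass (PSimplex.ofPath γ.toPath).loop = pointClass γ := by
  have h := pointClass_eq_of_path ⟨γ.rescale, γ.continuous_rescale⟩
  rw [ContinuousMap.coe_mk, γ.rescale_zero, γ.rescale_one] at h
  exact h.symm

lemma PSimplex.loop_toPath_apply (σ : PSimplex X b 1) (t : unitInterval) :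
    σ.loop.toPath t = σ.1 (edgePoint (Real.toNNReal t)) :=
  congrArg (fun s => σ.1 (edgePoint s)) (one_mul (Real.toNNReal t))

lemma PSimplex.ofPath_loop_toPath (σ : PSimplex X b 1) : ofPath σ.loop.toPath = σ :=
  Subtype.ext <| ContinuousMap.ext fun x =>
    (σ.loop_toPath_apply (baryCoord 1 x)).trans (congrArg σ.1 (edgePoint_baryCoord_one x))

lemma PSimplex.loop_toPath_ofPath (p : Path b b) : (ofPath p).loop.toPath = p := by
  ext t
  refine (loop_toPath_apply _ t).trans (congrArg p (Subtype.ext ?_))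
  change min (Real.toNNReal t : ℝ) 1 = t
  rw [Real.coe_toNNReal _ t.2.1, min_eq_left t.2.2]

end MooreLoops

section Comparison

variable {X : Type u} [TopologicalSpace X] {b : X}

variable (X b) in
/-- The algebra map from `H₀(Ω_b X; ℚ)` to the group algebra of the fundamental group. -/
def H0Loops.toPi1 : H0Loops X b →ₐ[ℚ] MonoidAlgebra ℚ (Pi1 X b) :=
  pointClassLift ((MonoidAlgebra.of ℚ _).comp (Pi1.ofMooreLoop X b)) fun Γ =>
    congrArg (MonoidAlgebra.of ℚ _)
      (Pi1.mk_eq_of_homotopic (MooreLoop.homotopic_toPath_of_path Γ))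

lemma H0Loops.toPi1_pointClass (γ : MooreLoop X b) :
    H0Loops.toPi1 X b (pointClass γ) = MonoidAlgebra.single (Pi1.mk γ.toPath) 1 :=
  pointClassLift_pointClass _ _ γ

variable (X b) in
/-- The algebra map from the group algebra of the fundamental group to `H₀(Ω C_*(X, b; ℚ))`. -/
def H0Cobar.ofPi1 : MonoidAlgebra ℚ (Pi1 X b) →ₐ[ℚ] H0Cobar X b :=
  MonoidAlgebra.lift ℚ _ _ (Pi1.toH0Cobar X b)

lemma H0Cobar.ofPi1_single_mk (p : Path b b) :
    H0Cobar.ofPi1 X b (MonoidAlgebra.single (Pi1.mk p) 1) = edge (PSimplex.ofPath p) :=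
  (MonoidAlgebra.lift_single ..).trans (one_smul ℚ _)

variable (X b) in
/-- The algebra map from `H₀(Ω C_*(X, b; ℚ))` to the group algebra of the fundamental group which
factors through `H₀(θ)`. -/
def H0Cobar.toPi1 : H0Cobar X b →ₐ[ℚ] MonoidAlgebra ℚ (Pi1 X b) :=
  (H0Loops.toPi1 X b).comp (H0theta X b)

lemma H0Cobar.toPi1_edge (σ : PSimplex X b 1) :
    H0Cobar.toPi1 X b (edge σ) = MonoidAlgebra.single (Pi1.mk σ.loop.toPath) 1 := by
  rw [toPi1, AlgHom.comp_apply, H0theta_edge, H0Loops.toPi1_pointClass]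

lemma H0Cobar.ofPi1_comp_toPi1 :
    (H0Cobar.ofPi1 X b).comp (H0Cobar.toPi1 X b) = AlgHom.id ℚ _ :=
  hom_ext fun σ => by
    rw [AlgHom.comp_apply, toPi1_edge, ofPi1_single_mk, PSimplex.ofPath_loop_toPath,
      AlgHom.id_apply]

lemma H0Cobar.toPi1_comp_ofPi1 :
    (H0Cobar.toPi1 X b).comp (H0Cobar.ofPi1 X b) = AlgHom.id ℚ _ := by
  refine MonoidAlgebra.algHom_ext (fun g => ?_) (Subsingleton.elim _ _)
  obtain ⟨p, rfl⟩ := Pi1.mk_surjective g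
  rw [AlgHom.comp_apply, ofPi1_single_mk, toPi1_edge, PSimplex.loop_toPath_ofPath, AlgHom.id_apply]

lemma H0theta_comp_ofPi1_comp_toPi1 :
    ((H0theta X b).comp (H0Cobar.ofPi1 X b)).comp (H0Loops.toPi1 X b) = AlgHom.id ℚ _ :=
  algHom_ext_pointClass fun γ => by
    rw [AlgHom.comp_apply, AlgHom.comp_apply, H0Loops.toPi1_pointClass, H0Cobar.ofPi1_single_mk,
      H0theta_edge, pointClass_loop_ofPath, AlgHom.id_apply]

variable (X b) in
/-- The isomorphism `κ : H₀(Ω_b X; ℚ) ≅ ℚ[π₁(X, b)]`. -/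
def H0Loops.equivPi1 : H0Loops X b ≃ₐ[ℚ] MonoidAlgebra ℚ (Pi1 X b) :=
  AlgEquiv.ofAlgHom (H0Loops.toPi1 X b) ((H0theta X b).comp (H0Cobar.ofPi1 X b))
    H0Cobar.toPi1_comp_ofPi1 H0theta_comp_ofPi1_comp_toPi1

lemma isGroupLikeElem_edge (σ : PSimplex X b 1) : IsGroupLikeElem ℚ (edge σ) :=
  ⟨H0Cobar.counit_edge σ, H0Cobar.comul_edge σ⟩

variable (X b) in
/-- The isomorphism of bialgebras `Φ : H₀(Ω C_*(X, b; ℚ)) ≅ ℚ[π₁(X, b)]`. -/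
def H0Cobar.equivPi1 : H0Cobar X b ≃ₐc[ℚ] MonoidAlgebra ℚ (Pi1 X b) :=
  BialgEquiv.ofAlgEquiv
    (AlgEquiv.ofAlgHom (H0Cobar.toPi1 X b) (H0Cobar.ofPi1 X b) toPi1_comp_ofPi1 ofPi1_comp_toPi1)
    (hom_ext fun σ => by
      change Coalgebra.counit (R := ℚ) (toPi1 X b (edge σ)) = Coalgebra.counit (R := ℚ) (edge σ)
      rw [toPi1_edge, (isGroupLikeElem_edge σ).counit_eq_one]
      exact (MonoidAlgebra.isGroupLikeElem_of _).counit_eq_one)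
    (hom_ext fun σ => by
      change TensorProduct.map (toPi1 X b).toLinearMap (toPi1 X b).toLinearMap
        (Coalgebra.comul (R := ℚ) (edge σ)) = Coalgebra.comul (R := ℚ) (toPi1 X b (edge σ))
      rw [(isGroupLikeElem_edge σ).comul_eq_tmul_self, TensorProduct.map_tmul,
        AlgHom.toLinearMap_apply, toPi1_edge]
      exact (MonoidAlgebra.isGroupLikeElem_of _).comul_eq_tmul_self.symm)

lemma H0Cobar.equivPi1_apply (x : H0Cobar X b) :
    H0Cobar.equivPi1 X b x = H0Loops.equivPi1 X b (H0theta X b x) := rfl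

lemma H0theta_bijective : Function.Bijective (H0theta X b) :=
  ((H0Loops.equivPi1 X b).bijective.of_comp_iff' _).1 (H0Cobar.equivPi1 X b).bijective

lemma IsAdamsMap.H0map_eq {θ : Cobar X b →ₐ[ℚ] LoopChains X b} (hθ : IsAdamsMap θ) :
    hθ.toIsDGHom.H0map = H0theta X b :=
  H0Cobar.hom_ext fun σ => by
    obtain ⟨c, hc, hdc⟩ := hθ.edge σ
    rw [H0theta_edge, ← sub_eq_zero, LoopCobar.edge, pointClass]
    change H0.mk _ _ _ - H0.mk _ _ _ = 0
    rw [← map_sub, H0.mk_eq_zero]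
    refine ⟨c, hc, hdc.trans ?_⟩
    change _ = θ (cubeGen σ) - CubeChains.of (Cube.point σ.loop)
    rw [cubeGen, map_add, map_one]
    abel

variable (X b) in
/-- The isomorphism `e` from `π₁(X, b)` to the group of group-like elements of
`H₀(Ω C_*(X, b; ℚ))`. -/
def Pi1.equivGroupLike : Pi1 X b ≃* GroupLike ℚ (H0Cobar X b) :=
  (groupLikeMonoidAlgebra ℚ (Pi1 X b)).trans (groupLikeCongr (H0Cobar.equivPi1 X b).symm)

lemma H0Cobar.equivPi1_equivGroupLike (g : Pi1 X b) :
    H0Cobar.equivPi1 X b (Pi1.equivGroupLike X b g).val = MonoidAlgebra.single g 1 :=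
  (H0Cobar.equivPi1 X b).apply_symm_apply _

end Comparison

section Functoriality

variable {X Y Z : Type u} [TopologicalSpace X] [TopologicalSpace Y] [TopologicalSpace Z]
  {b : X} {c : Y} {d : Z}

lemma H0Cobar.map_edge (f : C(X, Y)) (hf : f b = c) (σ : PSimplex X b 1) :
    H0Cobar.map f hf (edge σ) = edge (σ.map f hf) :=
  H0map_edge f hf σ

lemma H0Cobar.bialgHom_ext {W : Type*} [Ring W] [Bialgebra ℚ W] {f g : H0Cobar X b →ₐc[ℚ] W}
    (h : ∀ σ : PSimplex X b 1, f (edge σ) = g (edge σ)) : f = g :=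
  BialgHom.ext fun x => AlgHom.congr_fun
    (hom_ext (f := (f : H0Cobar X b →ₐ[ℚ] W)) (g := (g : H0Cobar X b →ₐ[ℚ] W)) h) x

lemma PSimplex.mk_loop_toPath_map (f : C(X, Y)) (hf : f b = c) (σ : PSimplex X b 1) :
    Pi1.mk (σ.map f hf).loop.toPath = Pi1.map f hf (Pi1.mk σ.loop.toPath) :=
  (Pi1.map_mk f hf σ.loop.toPath).symm

lemma H0Cobar.equivPi1_map (f : C(X, Y)) (hf : f b = c) (x : H0Cobar X b) :
    H0Cobar.equivPi1 Y c (H0Cobar.map f hf x) =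
      MonoidAlgebra.mapDomainBialgHom ℚ (Pi1.map f hf) (H0Cobar.equivPi1 X b x) := by
  suffices h : (H0Cobar.equivPi1 Y c : _ →ₐc[ℚ] _).comp (H0Cobar.map f hf) =
      (MonoidAlgebra.mapDomainBialgHom ℚ (Pi1.map f hf)).comp (H0Cobar.equivPi1 X b) from
    DFunLike.congr_fun h x
  refine bialgHom_ext fun σ => ?_
  change toPi1 Y c (H0Cobar.map f hf (edge σ)) =
    MonoidAlgebra.mapDomainBialgHom ℚ (Pi1.map f hf) (toPi1 X b (edge σ))
  rw [map_edge, toPi1_edge, toPi1_edge, MonoidAlgebra.mapDomainBialgHom_single,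
    PSimplex.mk_loop_toPath_map]

lemma Pi1.equivGroupLike_map (f : C(X, Y)) (hf : f b = c) (g : Pi1 X b) :
    (Pi1.equivGroupLike Y c (Pi1.map f hf g)).val =
      H0Cobar.map f hf (Pi1.equivGroupLike X b g).val := by
  apply EquivLike.injective (H0Cobar.equivPi1 Y c)
  rw [H0Cobar.equivPi1_map, H0Cobar.equivPi1_equivGroupLike, H0Cobar.equivPi1_equivGroupLike,
    MonoidAlgebra.mapDomainBialgHom_single]

lemma H0Cobar.map_id :
    H0Cobar.map (ContinuousMap.id X) (rfl : ContinuousMap.id X b = b) =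
      BialgHom.id ℚ (H0Cobar X b) :=
  bialgHom_ext fun σ => map_edge (ContinuousMap.id X) rfl σ

lemma H0Cobar.map_comp (f : C(X, Y)) (hf : f b = c) (g : C(Y, Z)) (hg : g c = d) :
    H0Cobar.map (g.comp f) ((congrArg g hf).trans hg) =
      (H0Cobar.map g hg).comp (H0Cobar.map f hf) :=
  bialgHom_ext fun σ => by
    rw [BialgHom.comp_apply, map_edge, map_edge, map_edge]
    rfl

end Functoriality

end

end LoopCobar

theorem mainTheorem3_general :
    ∃ (κ : ∀ (X : Type u) [TopologicalSpace X] (b : X),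
          H0Loops X b ≃ₐ[ℚ] MonoidAlgebra ℚ (Pi1 X b))
      (Φ : ∀ (X : Type u) [TopologicalSpace X] (b : X),
          H0Cobar X b ≃ₐc[ℚ] MonoidAlgebra ℚ (Pi1 X b))
      (e : ∀ (X : Type u) [TopologicalSpace X] (b : X),
          Pi1 X b ≃* GroupLike ℚ (H0Cobar X b)),
      (∀ (X : Type u) [TopologicalSpace X] (b : X),
        (∀ γ : MooreLoop X b,
          κ X b (pointClass γ) = MonoidAlgebra.single (Pi1.mk γ.toPath) 1) ∧
        (∀ x : H0Cobar X b, Φ X b x = κ X b (H0theta X b x)) ∧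
        Function.Bijective (H0theta X b) ∧
        (∀ (θ : Cobar X b →ₐ[ℚ] LoopChains X b) (hθ : IsAdamsMap θ),
          hθ.toIsDGHom.H0map = H0theta X b) ∧
        (∃ h : HopfAlgebra ℚ (H0Cobar X b),
          h.toBialgebra = (inferInstance : Bialgebra ℚ (H0Cobar X b))) ∧
        (∀ g : Pi1 X b, Φ X b (e X b g).val = MonoidAlgebra.single g 1)) ∧
      (∀ (X Y : Type u) [TopologicalSpace X] [TopologicalSpace Y] (b : X) (c : Y)
          (f : C(X, Y)) (hf : f b = c),
        (∀ x : H0Cobar X b, Φ Y c (H0Cobar.map f hf x) =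
          MonoidAlgebra.mapDomainBialgHom ℚ (Pi1.map f hf) (Φ X b x)) ∧
        (∀ g : Pi1 X b, (e Y c (Pi1.map f hf g)).val = H0Cobar.map f hf (e X b g).val)) ∧
      (∀ (X : Type u) [TopologicalSpace X] (b : X),
        H0Cobar.map (ContinuousMap.id X) (rfl : ContinuousMap.id X b = b) =
          BialgHom.id ℚ (H0Cobar X b)) ∧
      (∀ (X Y Z : Type u) [TopologicalSpace X] [TopologicalSpace Y] [TopologicalSpace Z]
          (b : X) (c : Y) (d : Z) (f : C(X, Y)) (hf : f b = c) (g : C(Y, Z)) (hg : g c = d),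
        H0Cobar.map (g.comp f) ((congrArg g hf).trans hg) =
          (H0Cobar.map g hg).comp (H0Cobar.map f hf)) := by
  refine ⟨fun X _ b => H0Loops.equivPi1 X b, fun X _ b => H0Cobar.equivPi1 X b,
    fun X _ b => Pi1.equivGroupLike X b, fun X _ b => ?_, fun X Y _ _ b c f hf => ?_,
    fun X _ b => H0Cobar.map_id, fun X Y Z _ _ _ b c d f hf g hg => H0Cobar.map_comp f hf g hg⟩
  · exact ⟨H0Loops.toPi1_pointClass, H0Cobar.equivPi1_apply, H0theta_bijective,
      fun _ hθ => hθ.H0map_eq, ⟨hopfAlgebraOfBialgEquiv (H0Cobar.equivPi1 X b), rfl⟩,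
      H0Cobar.equivPi1_equivGroupLike⟩
  · exact ⟨H0Cobar.equivPi1_map f hf, Pi1.equivGroupLike_map f hf⟩

theorem mainTheorem3 :
    ∃ (κ : ∀ (X : Type u) [TopologicalSpace X] [PathConnectedSpace X] (b : X),
          H0Loops X b ≃ₐ[ℚ] MonoidAlgebra ℚ (Pi1 X b))
      (Φ : ∀ (X : Type u) [TopologicalSpace X] [PathConnectedSpace X] (b : X),
          H0Cobar X b ≃ₐc[ℚ] MonoidAlgebra ℚ (Pi1 X b))
      (e : ∀ (X : Type u) [TopologicalSpace X] [PathConnectedSpace X] (b : X),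
          Pi1 X b ≃* GroupLike ℚ (H0Cobar X b)),
      (∀ (X : Type u) [TopologicalSpace X] [PathConnectedSpace X] (b : X),
        (∀ γ : MooreLoop X b,
          κ X b (pointClass γ) = MonoidAlgebra.single (Pi1.mk γ.toPath) 1) ∧
        (∀ x : H0Cobar X b, Φ X b x = κ X b (H0theta X b x)) ∧
        Function.Bijective (H0theta X b) ∧
        (∀ (θ : Cobar X b →ₐ[ℚ] LoopChains X b) (hθ : IsAdamsMap θ),
          hθ.toIsDGHom.H0map = H0theta X b) ∧
        (∃ h : HopfAlgebra ℚ (H0Cobar X b),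
          h.toBialgebra = (inferInstance : Bialgebra ℚ (H0Cobar X b))) ∧
        (∀ g : Pi1 X b, Φ X b (e X b g).val = MonoidAlgebra.single g 1)) ∧
      (∀ (X Y : Type u) [TopologicalSpace X] [PathConnectedSpace X] [TopologicalSpace Y]
          [PathConnectedSpace Y] (b : X) (c : Y) (f : C(X, Y)) (hf : f b = c),
        (∀ x : H0Cobar X b, Φ Y c (H0Cobar.map f hf x) =
          MonoidAlgebra.mapDomainBialgHom ℚ (Pi1.map f hf) (Φ X b x)) ∧
        (∀ g : Pi1 X b, (e Y c (Pi1.map f hf g)).val = H0Cobar.map f hf (e X b g).val)) ∧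
      (∀ (X : Type u) [TopologicalSpace X] [PathConnectedSpace X] (b : X),
        H0Cobar.map (ContinuousMap.id X) (rfl : ContinuousMap.id X b = b) =
          BialgHom.id ℚ (H0Cobar X b)) ∧
      (∀ (X Y Z : Type u) [TopologicalSpace X] [PathConnectedSpace X] [TopologicalSpace Y]
          [PathConnectedSpace Y] [TopologicalSpace Z] [PathConnectedSpace Z]
          (b : X) (c : Y) (d : Z) (f : C(X, Y)) (hf : f b = c) (g : C(Y, Z)) (hg : g c = d),
        H0Cobar.map (g.comp f) ((congrArg g hf).trans hg) =
          (H0Cobar.map g hg).comp (H0Cobar.map f hf)) := by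
  obtain ⟨κ, Φ, e, h, hmap, hid, hcomp⟩ := mainTheorem3_general.{u}
  exact ⟨fun X _ _ b => κ X b, fun X _ _ b => Φ X b, fun X _ _ b => e X b,
    fun X _ _ b => h X b, fun X Y _ _ _ _ => hmap X Y, fun X _ _ => hid X,
    fun X Y Z _ _ _ _ _ _ => hcomp X Y Z⟩
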